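/- **Model.** Let $G=(V,E)$ be a finite graph and let each vertex $v$ carry an input bit $x_v\in\{0,1\}$; $v$ is *marked* if $x_v=1$. A quantum robot on $G$ has a state $\sum_{v,z}\alpha_{v,z}|v,z\rangle$, where $v\in V$ is its location and $z\in\{0,1\}^m$ (with $m\ge 1$ arbitrary but fixed for the robot) its internal configuration. Starting in $|v_1,0\rangle$ for a given vertex $v_1$, a run of $T$ steps applies $U^{(1)},O,U^{(2)},O,\dots,U^{(T)},O$, where the oracle step $O$ maps $|v,z\rangle$ to $|v,z\oplus x_v\rangle$ ($x_v$ is XOR'ed into the first bit of $z$), and each $U^{(t)}$ is a unitary that does not depend on $x$ and is *C-local*: the basis states can be partitioned into classes so that $U^{(t)}$ has zero entries between distinct classes and the basis states of each class are all from one vertex or from two adjacent vertices. The robot evaluates a partial Boolean function $f$ of $x=(x_v)_{v\in V}$ in $T$ steps if, on every input $x$ in the domain of $f$, measuring a designated bit of $z$ after the run gives $f(x)$ with probability at least $2/3$. Let $Q(f,G)$ be the least $T$ for which some quantum robot on $G$ evaluates $f$ in $T$ steps. Let $\mathcal L_d(n)$, for $n=\ell^d$, be the $d$-dimensional grid graph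 on $\{1,\dots,\ell\}^d$, in which two vertices are adjacent if they differ by $1$ in exactly one coordinate and agree in the others. For $k\ge1$ let $\mathrm{OR}^{(k)}$ (respectively $\mathrm{OR}^{(\ge k)}$) be the problem of deciding whether there are no marked vertices or exactly $k$ (respectively at least $k$) of them, given that one of these is true. **Theorem.** For all $n=\ell^d$ and $1\le k\le n$ (and $n\ge2$ when $d=2$), with constants in the $O$-notation that depend only on $d$ (not on $n$, $k$ or the starting vertex $v_1$): 1. for $d\ge 3$, $\;Q(\mathrm{OR}^{(k)},\mathcal L_d(n))=O\!\left(\dfrac{\sqrt n}{k^{1/2-1/d}}\right)$; 2. for $d=2$, $\;Q(\mathrm{OR}^{(k)},\mathcal L_2(n))=O\!\left(\sqrt n\,\log^{3/2}n\right)$; 3. for $d\ge 3$, $\;Q(\mathrm{OR}^{(\ge k)},\mathcal L_d(n))=O\!\left(\dfrac{\sqrt n}{k^{1/2-1/d}}\right)$; 4. for $d=2$, $\;Q(\mathrm{OR}^{(\ge k)},\mathcal L_2(n))=O\!\left(\sqrt n\,\log^{5/2}n\right)$. -/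

import Mathlib

open scoped Matrix

/-- The `d`-dimensional grid graph with side length `ℓ` (so with `n = ℓ ^ d` vertices): two vertices
are adjacent if one is obtained from the other by adding `1` to a single coordinate. -/
def gridGraph (d ℓ : ℕ) : SimpleGraph (Fin d → Fin ℓ) where
  Adj u v := ∃ j, (∀ i, i ≠ j → u i = v i) ∧
    ((u j : ℕ) + 1 = (v j : ℕ) ∨ (v j : ℕ) + 1 = (u j : ℕ))
  symm := ⟨fun _ _ ⟨j, h, h'⟩ => ⟨j, fun i hi => (h i hi).symm, h'.symm⟩⟩
  loopless := ⟨fun _ ⟨_, _, h⟩ => by omega⟩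

/-- The basis states `|v, z⟩` of a robot on the vertex set `V`, whose internal configuration `z` is
a string of `m + 1` bits. -/
abbrev RobotBasis (V : Type*) (m : ℕ) : Type _ := V × (Fin (m + 1) → Bool)

/-- C-locality: the basis states can be partitioned into classes (here: the classes of an
equivalence relation `P`) such that `U` has zero entries between distinct classes, and the states
in any one class are all from the same vertex or from two adjacent vertices. -/
def IsCLocal {V : Type*} (G : SimpleGraph V) {m : ℕ}
    (U : Matrix (RobotBasis V m) (RobotBasis V m) ℂ) : Prop :=
  ∃ P : Setoid (RobotBasis V m),
    (∀ a b, ¬ P a b → U b a = 0) ∧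
    (∀ a, ∃ v w : V, (v = w ∨ G.Adj v w) ∧ ∀ b, P a b → b.1 = v ∨ b.1 = w)

/-- A quantum robot on the graph `G`: its algorithm steps (which do not depend on the input), all of
them unitary and C-local, and the position of the output bit `z_OUT`. A run of `T` steps uses
`step 0, …, step (T - 1)`. -/
structure QuantumRobot {V : Type*} [Fintype V] [DecidableEq V] (G : SimpleGraph V) where
  extraBits : ℕ
  step : ℕ → Matrix (RobotBasis V extraBits) (RobotBasis V extraBits) ℂ
  unitary : ∀ t, step t ∈ Matrix.unitaryGroup (RobotBasis V extraBits) ℂ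
  cLocal : ∀ t, IsCLocal G (step t)
  outBit : Fin (extraBits + 1)

/-- The oracle step for the input `X`: it maps `|v, z⟩` to `|v, z ⊕ X v⟩`, with `X v` exclusive-OR'ed
into the first bit of `z`. This map on basis states is an involution, so the new amplitude of
`|v, z⟩` is the old amplitude of `|v, z ⊕ X v⟩`. -/
def oracleStep {V : Type*} {m : ℕ} (X : V → Bool) (ψ : RobotBasis V m → ℂ) :
    RobotBasis V m → ℂ :=
  fun a => ψ (a.1, Function.update a.2 0 (xor (a.2 0) (X a.1)))

namespace QuantumRobot

variable {V : Type*} [Fintype V] [DecidableEq V] {G : SimpleGraph V}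

/-- The state immediately after the `t`-th oracle step on input `X`, from the initial state
`|v₁, 0⟩`. -/
noncomputable def state (A : QuantumRobot G) (v₁ : V) (X : V → Bool) :
    ℕ → RobotBasis V A.extraBits → ℂ
  | 0 => Pi.single (v₁, fun _ => false) 1
  | t + 1 => oracleStep X (A.step t *ᵥ A.state v₁ X t)

/-- The probability that the output bit equals `b` after `T` algorithm steps and `T` oracle
steps. -/
noncomputable def outProb (A : QuantumRobot G) (v₁ : V) (X : V → Bool) (T : ℕ) (b : Bool) : ℝ :=
  ∑ a : RobotBasis V A.extraBits, if a.2 A.outBit = b then ‖A.state v₁ X T a‖ ^ 2 else 0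

/-- `A`, started at `v₁` and run for `T` steps, evaluates the partial Boolean function `f` with
probability at least `2/3` on every input of its domain. -/
def Evaluates (A : QuantumRobot G) (v₁ : V) (T : ℕ) (f : (V → Bool) → Option Bool) : Prop :=
  ∀ X b, f X = some b → 2 / 3 ≤ A.outProb v₁ X T b

end QuantumRobot

/-- `Q(f, G)` for robots started at `v₁`: the least number of steps of a quantum robot on `G` with
C-local steps that evaluates `f` with probability at least `2/3` (`⊤` if there is none). -/
noncomputable def robotComplexity {V : Type*} [Fintype V] [DecidableEq V] (G : SimpleGraph V)
    (v₁ : V) (f : (V → Bool) → Option Bool) : ℕ∞ :=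
  sInf {N : ℕ∞ | ∃ T : ℕ, N = T ∧ ∃ A : QuantumRobot G, A.Evaluates v₁ T f}

/-- The number of marked vertices of an input. -/
def markedCount {V : Type*} [Fintype V] (X : V → Bool) : ℕ :=
  (Finset.univ.filter fun v => X v = true).card

/-- `OR^(k)`, for `k ≥ 1`: decide whether there are no marked vertices or exactly `k` of them, given
that one of these is true. -/
def orExactly {V : Type*} [Fintype V] (k : ℕ) (X : V → Bool) : Option Bool :=
  if markedCount X = 0 then some false else if markedCount X = k then some true else none

/-- `OR^(≥ k)`, for `k ≥ 1`: decide whether there are no marked vertices or at least `k` of them,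
given that one of these is true. -/
def orAtLeast {V : Type*} [Fintype V] (k : ℕ) (X : V → Bool) : Option Bool :=
  if markedCount X = 0 then some false else if k ≤ markedCount X then some true else none

/-! ### Register programs of a robot. -/

set_option linter.unusedSectionVars false

/-! Suppose the number of marked vertices lies between κ and 2κ. Cut the grid into cells of side s,
with s^d of order κ, and keep one random point of each cell. A second-moment estimate shows that,
with probability bounded below in terms of d, exactly one kept point is marked
(`le_card_filter_card_eq_one`, `exists_grid_hierarchy`). It remains to search for a unique target.

The target is found by amplitude amplification nested over a hierarchy of cubes. Cells are addressed
by base-b digits, and the search of level r reaches the target once the digits from r upwards are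
right. Spreading digit r uniformly divides the amplitude by b^(d/2) and costs walks of order s
b^(r+1) (`HasSearch.succ`). Each round of amplification turns sin θ into sin 3θ and about triples
the cost (`HasSearch.amplify`). As the target is unique, amplitudes are known exactly and no errors
accumulate.

For d ≥ 3 take b = 8 and two rounds per level. The cost grows by 9 per level and the walks only by
8, so R levels cost O(s 9^R), while the amplitude is of order (9 / 8^(d/2))^R. Cost over amplitude
is of order s 8^(Rd/2), about s (ℓ/s)^(d/2), which is √n / κ^(1/2 - 1/d) for s of order κ^(1/d). For
d = 2 take b = 3 and one round: costs and walks both grow by 3, so the levels contribute equally and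
give O(ℓ log n), and the cubic losses leave an amplitude of 1/√(R+1). The quotient is ℓ log^(3/2) n.

A last amplification makes the success probability constant. The error is one-sided, since no flag
is raised on the empty input, so procedures for several guesses κ can be run in turn
(`exists_robotComplexity_eq_of_guesses`). The guesses k, 2k, 4k, ... cost a geometric series for d ≥
3 and one more logarithm for d = 2.

All programs are written in `Simulates`, where the location is a function of the registers, so that
only register unitaries need to be multiplied; `Simulates.exists_steps` turns them into C-local
steps. -/

theorem unitary_of_mul_conjTranspose {n : Type*} [Fintype n] [DecidableEq n] {U : Matrix n n ℂ}
    (h : U * Uᴴ = 1) : U ∈ Matrix.unitaryGroup n ℂ :=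
  Matrix.mem_unitaryGroup_iff.2 h

theorem involution_mem_unitaryGroup {n : Type*} [Fintype n] [DecidableEq n] {σ : n → n}
    (hσ : Function.Involutive σ) :
    (Matrix.of fun b a => if a = σ b then (1 : ℂ) else 0) ∈ Matrix.unitaryGroup n ℂ := by
  rw [Matrix.mem_unitaryGroup_iff]
  ext b a
  simp only [Matrix.star_eq_conjTranspose, Matrix.mul_apply, Matrix.conjTranspose_apply,
    Matrix.of_apply, ite_mul, one_mul, zero_mul, Finset.sum_ite_eq', Finset.mem_univ, if_true,
    Matrix.one_apply, hσ.injective.eq_iff]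
  split_ifs <;> simp

/-- The register operator that applies `K x` if the queried bit at the location is `x`. -/
def queryMatrix {V Y : Type*} (loc : Y → V) (K : Bool → Matrix Y Y ℂ) (X : V → Bool) :
    Matrix Y Y ℂ :=
  Matrix.of fun y' y => K (X (loc y)) y' y

theorem conjTranspose_queryMatrix {V Y : Type*} (loc : Y → V) (K : Bool → Matrix Y Y ℂ)
    (hloc : ∀ x y y', K x y' y ≠ 0 → loc y' = loc y) (X : V → Bool) :
    (queryMatrix loc K X)ᴴ = queryMatrix loc (fun x => (K x)ᴴ) X := by
  ext y' y
  simp only [queryMatrix, Matrix.conjTranspose_apply, Matrix.of_apply]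
  by_cases h : loc y = loc y'
  · rw [h]
  · have h1 : ∀ x, K x y y' = 0 := fun x => by
      by_contra hx
      exact h (hloc x _ _ hx)
    simp [h1]

/-- Each column is taken from the `K x` of its own location. Columns that see different bits belong
to different locations and are supported there, hence they are orthogonal. -/
theorem queryMatrix_mem_unitaryGroup {V Y : Type*} [Fintype Y] [DecidableEq Y] (loc : Y → V)
    (K : Bool → Matrix Y Y ℂ) (hU : ∀ x, K x ∈ Matrix.unitaryGroup Y ℂ)
    (hloc : ∀ x y y', K x y' y ≠ 0 → loc y' = loc y) (X : V → Bool) :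
    queryMatrix loc K X ∈ Matrix.unitaryGroup Y ℂ := by
  rw [Matrix.mem_unitaryGroup_iff']
  ext y y''
  simp only [Matrix.star_eq_conjTranspose, Matrix.mul_apply, queryMatrix,
    Matrix.conjTranspose_apply, Matrix.of_apply]
  by_cases h : X (loc y) = X (loc y'')
  · have := congrFun (congrFun (Matrix.mem_unitaryGroup_iff'.1 (hU (X (loc y'')))) y) y''
    simp only [Matrix.star_eq_conjTranspose, Matrix.mul_apply, Matrix.conjTranspose_apply] at this
    rw [h, this]
  · have hne : y ≠ y'' := fun e => h (by rw [e])
    rw [Matrix.one_apply_ne hne]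
    refine Finset.sum_eq_zero fun w _ => ?_
    by_contra hw
    have h1 : K (X (loc y)) w y ≠ 0 := fun e => hw (by simp [e])
    have h2 : K (X (loc y'')) w y'' ≠ 0 := fun e => hw (by simp [e])
    exact h (by rw [← hloc _ _ _ h1, hloc _ _ _ h2])

/-- `Simulates G loc loc' T K`: with `T` robot steps, a robot with register `Y` and control
register `Ω`, whose location is the function `loc` of its registers, can apply the operator
`K X ω` to the register `Y`, after which its location is the function `loc'` of its registers. -/
inductive Simulates {V : Type*} (G : SimpleGraph V) {Ω Y : Type*} [Fintype Y] [DecidableEq Y] :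
    (Ω → Y → V) → (Ω → Y → V) → ℕ → ((V → Bool) → Ω → Matrix Y Y ℂ) → Prop
  | refl (loc) : Simulates G loc loc 0 (fun _ _ => 1)
  -- Two steps: the oracle after an idle step loads the bit, and the oracle after `K` erases it.
  | query (loc) (K : Ω → Bool → Matrix Y Y ℂ)
      (hU : ∀ ω x, K ω x ∈ Matrix.unitaryGroup Y ℂ)
      (hloc : ∀ ω x y y', K ω x y' y ≠ 0 → loc ω y' = loc ω y) :
      Simulates G loc loc 2 (fun X ω => queryMatrix (loc ω) (K ω) X)
  -- Two steps, so that the two oracle calls cancel.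
  | move (loc loc') (h : ∀ ω y, loc ω y = loc' ω y ∨ G.Adj (loc ω y) (loc' ω y)) :
      Simulates G loc loc' 2 (fun _ _ => 1)
  | comp {l₁ l₂ l₃ T T' K K'} : Simulates G l₁ l₂ T K → Simulates G l₂ l₃ T' K' →
      Simulates G l₁ l₃ (T + T') (fun X ω => K' X ω * K X ω)

/-! ### Combining register programs. -/

namespace Simulates

variable {V : Type*} {G : SimpleGraph V} {Ω Y : Type*} [Fintype Y] [DecidableEq Y]
  {loc loc' : Ω → Y → V} {T : ℕ} {K : (V → Bool) → Ω → Matrix Y Y ℂ}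

theorem congr {T' : ℕ} {K' : (V → Bool) → Ω → Matrix Y Y ℂ} (h : Simulates G loc loc' T K)
    (hT : T = T') (hK : ∀ X ω, K X ω = K' X ω) : Simulates G loc loc' T' K' := by
  obtain rfl : K = K' := funext fun X => funext fun ω => hK X ω
  exact hT ▸ h

theorem mem_unitaryGroup (h : Simulates G loc loc' T K) (X : V → Bool) (ω : Ω) :
    K X ω ∈ Matrix.unitaryGroup Y ℂ := by
  induction h with
  | refl => exact one_mem _
  | query loc K hU hloc => exact queryMatrix_mem_unitaryGroup _ _ (hU ω) (hloc ω) X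
  | move => exact one_mem _
  | comp _ _ h1 h2 => exact mul_mem h2 h1

/-- Programs run backwards at the same cost, because queries preserve the location and adjacency is
symmetric. Amplification and the undoing of walks rest on this. -/
theorem adjoint (h : Simulates G loc loc' T K) :
    Simulates G loc' loc T (fun X ω => (K X ω)ᴴ) := by
  induction h with
  | refl loc => exact (Simulates.refl loc).congr rfl (by simp)
  | query loc K hU hloc =>
    refine (Simulates.query loc (fun ω x => (K ω x)ᴴ) (fun ω x => ?_) ?_).congr rfl ?_
    · exact Unitary.star_mem (hU ω x)
    · intro ω x y y' hne
      rw [Matrix.conjTranspose_apply] at hne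
      exact (hloc ω x y' y (fun e => hne (by simp [e]))).symm
    · intro X ω
      rw [conjTranspose_queryMatrix _ _ (hloc ω)]
  | move l l' h =>
    exact (Simulates.move l' l fun ω y => (h ω y).imp Eq.symm fun h => h.symm).congr rfl (by simp)
  | comp _ _ h1 h2 => exact (h2.comp h1).congr (add_comm _ _) (by simp)

theorem local_op (loc : Ω → Y → V) (K : Ω → Matrix Y Y ℂ)
    (hU : ∀ ω, K ω ∈ Matrix.unitaryGroup Y ℂ)
    (hloc : ∀ ω y y', K ω y' y ≠ 0 → loc ω y' = loc ω y) :
    Simulates G loc loc 2 (fun _ ω => K ω) :=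
  Simulates.query loc (fun ω _ => K ω) (fun ω _ => hU ω) (fun ω _ => hloc ω)

/-- Walking along paths of length at most `D`, chosen by the registers. -/
theorem walk (D : ℕ) (loc loc' : Ω → Y → V)
    (h : ∀ ω y, ∃ p : G.Walk (loc ω y) (loc' ω y), p.length ≤ D) :
    Simulates G loc loc' (2 * D) (fun _ _ => 1) := by
  induction D generalizing loc with
  | zero =>
    have : loc = loc' := by
      funext ω y
      obtain ⟨p, hp⟩ := h ω y
      exact SimpleGraph.Walk.eq_of_length_eq_zero (Nat.le_zero.1 hp)
    subst this
    exact Simulates.refl loc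
  | succ D ih =>
    have : ∀ ω y, ∃ u, (loc ω y = u ∨ G.Adj (loc ω y) u) ∧
        ∃ p : G.Walk u (loc' ω y), p.length ≤ D := by
      intro ω y
      obtain ⟨p, hp⟩ := h ω y
      generalize loc ω y = a at p
      generalize loc' ω y = b at p
      cases p with
      | nil => exact ⟨_, Or.inl rfl, .nil, by simp⟩
      | cons hadj q =>
        exact ⟨_, Or.inr hadj, q, by simpa using hp⟩
    choose u hu hw using this
    exact ((Simulates.move loc u hu).comp (ih u hw)).congr (by ring) (by simp)

/-- Conjugating by a walk of length at most `D`. -/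
theorem conj_walk {loc₀ : Ω → Y → V} (D : ℕ) (hK : Simulates G loc₀ loc₀ T K)
    (h : ∀ ω y, ∃ p : G.Walk (loc ω y) (loc₀ ω y), p.length ≤ D) :
    Simulates G loc loc (T + 4 * D) K :=
  have hw := walk D loc loc₀ h
  ((hw.comp hK).comp hw.adjoint).congr (by ring) (by simp)

/-- A part of the control register as a part of the register. -/
theorem blockDiagonal {C : Type*} [Fintype C] [DecidableEq C] {W : Type*} [Fintype W]
    [DecidableEq W] (e : W ≃ Y × C) {loc loc' : Ω × C → Y → V}
    {K : (V → Bool) → Ω × C → Matrix Y Y ℂ} (h : Simulates G loc loc' T K) :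
    Simulates G (fun ω w => loc (ω, (e w).2) (e w).1) (fun ω w => loc' (ω, (e w).2) (e w).1) T
      (fun X ω => (Matrix.blockDiagonal fun c => K X (ω, c)).submatrix e e) := by
  have hone : (Matrix.blockDiagonal (fun _ : C => (1 : Matrix Y Y ℂ))).submatrix e e = 1 := by
    have : (fun _ : C => (1 : Matrix Y Y ℂ)) = 1 := rfl
    rw [this, Matrix.blockDiagonal_one, Matrix.submatrix_one_equiv]
  induction h with
  | refl loc => exact (Simulates.refl _).congr rfl fun X _ => hone.symm
  | query loc K hU hloc =>
    refine (Simulates.query _ (fun ω x => (Matrix.blockDiagonal fun c => K (ω, c) x).submatrix e e)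
      (fun ω x => ?_) ?_).congr rfl ?_
    · rw [Matrix.mem_unitaryGroup_iff, Matrix.star_eq_conjTranspose,
        Matrix.conjTranspose_submatrix, Matrix.submatrix_mul_equiv,
        Matrix.blockDiagonal_conjTranspose, ← Matrix.blockDiagonal_mul, ← hone]
      congr 2
      funext c
      exact Matrix.mem_unitaryGroup_iff.1 (hU (ω, c) x)
    · intro _ x w w' hne
      simp only [Matrix.submatrix_apply, Matrix.blockDiagonal_apply] at hne
      split_ifs at hne with h
      · rw [h] at hne ⊢
        exact hloc _ _ _ _ hne
      · exact absurd rfl hne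
    · intro X _
      ext w' w
      simp only [queryMatrix, Matrix.submatrix_apply, Matrix.blockDiagonal_apply, Matrix.of_apply]
      split_ifs with h
      · rw [h]
      · rfl
  | move l l' h => exact (Simulates.move _ _ fun _ w => h _ _).congr rfl fun X _ => hone.symm
  | comp _ _ h1 h2 =>
    refine (h1.comp h2).congr rfl fun X _ => ?_
    rw [Matrix.submatrix_mul_equiv, ← Matrix.blockDiagonal_mul]

theorem comap {Ω' : Type*} (h : Simulates G loc loc' T K) (σ : Ω' → Ω) :
    Simulates G (fun ω => loc (σ ω)) (fun ω => loc' (σ ω)) T (fun X ω => K X (σ ω)) := by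
  induction h with
  | refl loc => exact Simulates.refl _
  | query loc K hU hloc =>
    exact Simulates.query _ (fun ω => K (σ ω)) (fun ω => hU (σ ω)) (fun ω => hloc (σ ω))
  | move l l' h => exact Simulates.move _ _ fun ω => h (σ ω)
  | comp _ _ h1 h2 => exact h1.comp h2

end Simulates

/-! ### Extending a unitary along an embedding of basis states. -/

section Extension

variable {A B : Type*} [Fintype A] [DecidableEq A] [Fintype B] [DecidableEq B]

/-- The matrix of the embedding of basis states given by `f`. -/
def embMatrix (f : A → B) : Matrix B A ℂ := Matrix.of fun b a => if b = f a then 1 else 0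

theorem embMatrix_conjTranspose_mul {f : A → B} (hf : Function.Injective f) :
    (embMatrix f)ᴴ * embMatrix f = 1 := by
  ext a a'
  simp [embMatrix, Matrix.mul_apply, Matrix.one_apply, hf.eq_iff, eq_comm]

theorem embMatrix_mulVec_apply {f : A → B} (hf : Function.Injective f) (χ : A → ℂ) (a : A) :
    (embMatrix f *ᵥ χ) (f a) = χ a := by
  simp [embMatrix, Matrix.mulVec, dotProduct, hf.eq_iff]

theorem embMatrix_mulVec_apply_of_notMem {f : A → B} (χ : A → ℂ) {b : B} (hb : ∀ a, f a ≠ b) :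
    (embMatrix f *ᵥ χ) b = 0 := by
  simp only [embMatrix, Matrix.mulVec, dotProduct, Matrix.of_apply]
  exact Finset.sum_eq_zero fun a _ => by simp [(hb a).symm]

/-- The extension of `K`, along the embedding `f`, by the identity. -/
def extendMatrix (f : A → B) (K : Matrix A A ℂ) : Matrix B B ℂ :=
  1 + embMatrix f * (K - 1) * (embMatrix f)ᴴ

theorem extendMatrix_mem_unitaryGroup {f : A → B} (hf : Function.Injective f)
    {K : Matrix A A ℂ} (hK : K ∈ Matrix.unitaryGroup A ℂ) :
    extendMatrix f K ∈ Matrix.unitaryGroup B ℂ := by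
  have h1 := embMatrix_conjTranspose_mul hf
  have hKK : K * Kᴴ = 1 := Matrix.mem_unitaryGroup_iff.1 hK
  rw [Matrix.mem_unitaryGroup_iff, Matrix.star_eq_conjTranspose]
  simp only [extendMatrix, Matrix.conjTranspose_add, Matrix.conjTranspose_mul,
    Matrix.conjTranspose_one, Matrix.conjTranspose_sub, Matrix.conjTranspose_conjTranspose]
  set J := embMatrix f
  have h2 : J * (K - 1) * Jᴴ * (J * ((Kᴴ - 1) * Jᴴ)) = J * ((K - 1) * (Kᴴ - 1)) * Jᴴ := by
    calc _ = J * (K - 1) * (Jᴴ * J) * ((Kᴴ - 1) * Jᴴ) := by simp only [Matrix.mul_assoc]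
      _ = _ := by rw [h1, Matrix.mul_one]; simp only [Matrix.mul_assoc]
  have h3 : (K - 1) * (Kᴴ - 1) = 1 - K - Kᴴ + 1 := by
    rw [sub_mul, mul_sub, hKK]; simp; abel
  rw [add_mul, mul_add, mul_add, h2, h3]
  simp only [Matrix.mul_sub, Matrix.mul_add, Matrix.sub_mul, Matrix.add_mul, one_mul,
    Matrix.mul_one, ← Matrix.mul_assoc]
  abel

theorem extendMatrix_mulVec {f : A → B} (hf : Function.Injective f) (K : Matrix A A ℂ)
    (χ : A → ℂ) : extendMatrix f K *ᵥ (embMatrix f *ᵥ χ) = embMatrix f *ᵥ (K *ᵥ χ) := by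
  simp only [Matrix.mulVec_mulVec, extendMatrix]
  congr 1
  rw [Matrix.add_mul, Matrix.one_mul, Matrix.mul_assoc, embMatrix_conjTranspose_mul hf]
  simp [Matrix.mul_sub]

theorem extendMatrix_apply_ne_zero {f : A → B} {K : Matrix A A ℂ} {b a : B}
    (h : extendMatrix f K b a ≠ 0) :
    b = a ∨ ∃ b₀ a₀, b = f b₀ ∧ a = f a₀ ∧ (K b₀ a₀ ≠ 0 ∨ b₀ = a₀) := by
  by_contra hcon
  push Not at hcon
  obtain ⟨hne, hcon⟩ := hcon
  apply h
  simp only [extendMatrix, Matrix.add_apply, Matrix.one_apply_ne hne, Matrix.mul_apply, zero_add,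
    embMatrix, Matrix.of_apply, Matrix.conjTranspose_apply]
  refine Finset.sum_eq_zero fun a₀ _ => ?_
  by_cases ha : a = f a₀
  · rw [Finset.sum_eq_zero fun b₀ _ => ?_, zero_mul]
    by_cases hb : b = f b₀
    · obtain ⟨h1, h2⟩ := hcon b₀ a₀ hb ha
      simp [h1, Matrix.one_apply_ne h2]
    · simp [hb]
  · simp [ha]

end Extension

/-! ### From register programs to runs of a robot. -/

section Robot

variable {V : Type*} [Fintype V] [DecidableEq V] {G : SimpleGraph V} {m : ℕ}

theorem isCLocal_of_same_vertex {U : Matrix (RobotBasis V m) (RobotBasis V m) ℂ}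
    (h : ∀ a b, U b a ≠ 0 → b.1 = a.1) : IsCLocal G U := by
  refine ⟨Setoid.ker Prod.fst, fun a b hab => ?_, fun a => ⟨a.1, a.1, Or.inl rfl, fun b hb => ?_⟩⟩
  · by_contra hne
    exact hab (h a b hne).symm
  · exact Or.inl hb.symm

theorem isCLocal_one : IsCLocal G (1 : Matrix (RobotBasis V m) (RobotBasis V m) ℂ) :=
  isCLocal_of_same_vertex fun a b h => by
    by_contra hne
    exact h (Matrix.one_apply_ne fun e => hne (by rw [e]))

/-- The final state of a run of the algorithm steps in a list, each followed by an oracle step. -/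
noncomputable def runSteps (X : V → Bool) :
    List (Matrix (RobotBasis V m) (RobotBasis V m) ℂ) → (RobotBasis V m → ℂ) → RobotBasis V m → ℂ
  | [], ψ => ψ
  | U :: L, ψ => runSteps X L (oracleStep X (U *ᵥ ψ))

theorem runSteps_append (X : V → Bool) (L L' : List (Matrix (RobotBasis V m) (RobotBasis V m) ℂ))
    (ψ : RobotBasis V m → ℂ) : runSteps X (L ++ L') ψ = runSteps X L' (runSteps X L ψ) := by
  induction L generalizing ψ with
  | nil => rfl
  | cons U L ih => exact ih _

theorem oracleStep_oracleStep (X : V → Bool) (ψ : RobotBasis V m → ℂ) :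
    oracleStep X (oracleStep X ψ) = ψ := by
  funext a
  simp [oracleStep]

/-- The basis state of a robot whose first bit is `x` and whose register `w` is encoded by `enc`. -/
def encodeBasis {W : Type*} (enc : W → Fin (m + 1) → Bool) (a : V × Bool × W) : RobotBasis V m :=
  (a.1, Function.update (enc a.2.2) 0 a.2.1)

variable {W : Type*} [Fintype W] [DecidableEq W]

theorem encodeBasis_injective {enc : W → Fin (m + 1) → Bool} (henc : Function.Injective enc)
    (h0 : ∀ w, enc w 0 = false) : Function.Injective (encodeBasis (V := V) enc) := by
  rintro ⟨v, x, w⟩ ⟨v', x', w'⟩ h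
  simp only [encodeBasis, Prod.mk.injEq] at h
  obtain ⟨rfl, h⟩ := h
  have hx : x = x' := by simpa using congrFun h 0
  have hw : w = w' := henc <| by
    funext i
    by_cases hi : i = 0
    · rw [hi, h0, h0]
    · simpa [hi] using congrFun h i
  rw [hx, hw]

theorem oracleStep_embMatrix {enc : W → Fin (m + 1) → Bool} (henc : Function.Injective enc)
    (h0 : ∀ w, enc w 0 = false) (X : V → Bool) (χ : V × Bool × W → ℂ) :
    oracleStep X (embMatrix (encodeBasis enc) *ᵥ χ) =
      embMatrix (encodeBasis enc) *ᵥ fun a => χ (a.1, xor a.2.1 (X a.1), a.2.2) := by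
  have hf := encodeBasis_injective (V := V) henc h0
  funext b
  by_cases hb : ∃ a, encodeBasis enc a = b
  · obtain ⟨a, rfl⟩ := hb
    rw [embMatrix_mulVec_apply hf]
    have : ((encodeBasis enc a).1, Function.update (encodeBasis enc a).2 0
        (xor ((encodeBasis enc a).2 0) (X (encodeBasis enc a).1))) =
        encodeBasis enc (a.1, xor a.2.1 (X a.1), a.2.2) := by
      simp [encodeBasis]
    rw [oracleStep, this, embMatrix_mulVec_apply hf]
  · push Not at hb
    rw [embMatrix_mulVec_apply_of_notMem _ hb, oracleStep, embMatrix_mulVec_apply_of_notMem]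
    rintro a ha
    apply hb (a.1, xor a.2.1 (X a.1), a.2.2)
    obtain ⟨v, z⟩ := b
    simp only [encodeBasis, Prod.mk.injEq] at ha ⊢
    obtain ⟨rfl, ha⟩ := ha
    refine ⟨rfl, ?_⟩
    have h1 : a.2.1 = xor (z 0) (X a.1) := by simpa using congrFun ha 0
    rw [h1]
    funext i
    by_cases hi : i = 0
    · subst hi; simp
    · simpa [hi] using congrFun ha i

/-- The state of a robot with first bit `0` whose register is in the state `φ` and whose location
is a function of the register. -/
def locatedState (loc : W → V) (φ : W → ℂ) (a : V × Bool × W) : ℂ :=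
  if a.1 = loc a.2.2 ∧ a.2.1 = false then φ a.2.2 else 0

/-- The invariant is that the robot stands where its register says and that its query bit is clear.
Basis states that encode no register are fixed by every step. -/
theorem Simulates.exists_steps {enc : W → Fin (m + 1) → Bool} (henc : Function.Injective enc)
    (h0 : ∀ w, enc w 0 = false) {loc loc' : Unit → W → V} {T : ℕ}
    {K : (V → Bool) → Unit → Matrix W W ℂ} (h : Simulates G loc loc' T K) :
    ∃ L : List (Matrix (RobotBasis V m) (RobotBasis V m) ℂ), L.length = T ∧
      (∀ U ∈ L, U ∈ Matrix.unitaryGroup (RobotBasis V m) ℂ ∧ IsCLocal G U) ∧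
      ∀ X φ, runSteps X L (embMatrix (encodeBasis enc) *ᵥ locatedState (loc ()) φ) =
        embMatrix (encodeBasis enc) *ᵥ locatedState (loc' ()) (K X () *ᵥ φ) := by
  have hf := encodeBasis_injective (V := V) henc h0
  induction h with
  | refl loc => exact ⟨[], rfl, by simp, fun X φ => by simp [runSteps]⟩
  | query loc K hU hloc =>
    -- `K` is controlled by the query bit and acts at every vertex, also at those that do not match
    -- the register. This makes `M` block diagonal over vertex and bit, hence unitary and C-local.
    let M : Matrix (V × Bool × W) (V × Bool × W) ℂ :=
      Matrix.of fun b a => if b.1 = a.1 ∧ b.2.1 = a.2.1 then K () a.2.1 b.2.2 a.2.2 else 0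
    have hM : M ∈ Matrix.unitaryGroup _ ℂ := by
      rw [Matrix.mem_unitaryGroup_iff']
      ext ⟨v, x, w⟩ ⟨v', x', w'⟩
      simp only [Matrix.star_eq_conjTranspose, Matrix.mul_apply, Matrix.conjTranspose_apply, M,
        Matrix.of_apply, Fintype.sum_prod_type, Matrix.one_apply, Prod.mk.injEq]
      by_cases hv : v = v'
      · by_cases hx : x = x'
        · subst hv hx
          have := congrFun (congrFun (Matrix.mem_unitaryGroup_iff'.1 (hU () x)) w) w'
          simp only [Matrix.star_eq_conjTranspose, Matrix.mul_apply, Matrix.conjTranspose_apply,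
            Matrix.one_apply] at this
          rw [Finset.sum_eq_single v, Finset.sum_eq_single x]
          · simpa using this
          · intro y _ hy
            simp [hy]
          · simp
          · intro y _ hy
            simp [hy]
          · simp
        · rw [if_neg (by tauto)]
          refine Finset.sum_eq_zero fun v'' _ => Finset.sum_eq_zero fun x'' _ =>
            Finset.sum_eq_zero fun w'' _ => ?_
          by_cases h1 : x'' = x
          · simp [h1, hx]
          · simp [h1]
      · rw [if_neg (by tauto)]
        refine Finset.sum_eq_zero fun v'' _ => Finset.sum_eq_zero fun x'' _ =>
            Finset.sum_eq_zero fun w'' _ => ?_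
        by_cases h1 : v'' = v
        · simp [h1, hv]
        · simp [h1]
    refine ⟨[1, extendMatrix (encodeBasis enc) M], rfl, ?_, fun X φ => ?_⟩
    · intro U hUL
      simp only [List.mem_cons, List.not_mem_nil, or_false] at hUL
      rcases hUL with rfl | rfl
      · exact ⟨one_mem _, isCLocal_one⟩
      · refine ⟨extendMatrix_mem_unitaryGroup hf hM, isCLocal_of_same_vertex fun a b hne => ?_⟩
        rcases extendMatrix_apply_ne_zero hne with rfl | ⟨b₀, a₀, rfl, rfl, h | rfl⟩
        · rfl
        · by_contra hc
          exact h (if_neg fun h' => hc h'.1)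
        · rfl
    · simp only [runSteps, Matrix.one_mulVec]
      rw [oracleStep_embMatrix henc h0, extendMatrix_mulVec hf, oracleStep_embMatrix henc h0]
      congr 1
      funext ⟨v, x, w'⟩
      have hM' : ∀ χ : V × Bool × W → ℂ, ∀ v x w', (M *ᵥ χ) (v, x, w') =
          ∑ w, K () x w' w * χ (v, x, w) := by
        intro χ v x w'
        simp only [Matrix.mulVec, dotProduct, M, Matrix.of_apply, Fintype.sum_prod_type]
        rw [Finset.sum_eq_single v, Finset.sum_eq_single x]
        · simp
        · intro y _ hy
          simp [hy.symm]
        · simp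
        · intro y _ hy
          simp [hy.symm]
        · simp
      rw [hM']
      simp only [locatedState, Matrix.mulVec, dotProduct, queryMatrix, Matrix.of_apply]
      by_cases hx : x = false
      · subst hx
        by_cases hv : v = loc () w'
        · rw [if_pos ⟨hv, rfl⟩]
          refine Finset.sum_congr rfl fun w _ => ?_
          by_cases hl : loc () w' = loc () w
          · rw [hv, hl]; simp
          · have : ∀ x, K () x w' w = 0 := fun x => by
              by_contra hne
              exact hl (hloc () x _ _ hne)
            simp [this]
        · rw [if_neg (by tauto)]
          refine Finset.sum_eq_zero fun w _ => ?_
          by_cases hl : v = loc () w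
          · have : ∀ x, K () x w' w = 0 := fun x => by
              by_contra hne
              exact hv (hl.trans (hloc () x _ _ hne).symm)
            simp [this]
          · simp [hl]
      · rw [if_neg (by tauto)]
        refine Finset.sum_eq_zero fun w _ => ?_
        rw [if_neg, mul_zero]
        simp only [Bool.not_eq_false] at hx
        simp [hx]
  | move l l' hll =>
    classical
    let dec : (Fin (m + 1) → Bool) → Option W := fun z =>
      if h : ∃ w, enc w = z then some h.choose else none
    have hdec : ∀ w, dec (enc w) = some w := fun w => by
      have h : ∃ w', enc w' = enc w := ⟨w, rfl⟩
      simp only [dec, dif_pos h, henc h.choose_spec]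
    -- The two vertices are swapped, so that the step is an involution on all basis states; its
    -- classes join at most two vertices, equal or adjacent.
    let sw : (Fin (m + 1) → Bool) → V → V := fun z v =>
      (dec z).elim v fun w => Equiv.swap (l () w) (l' () w) v
    have hsw : ∀ z v, sw z (sw z v) = v := fun z v => by
      cases h : dec z <;> simp [sw, h]
    let M : Matrix (RobotBasis V m) (RobotBasis V m) ℂ :=
      Matrix.of fun b a => if a = (sw b.2 b.1, b.2) then 1 else 0
    have hMv : ∀ ψ b, (M *ᵥ ψ) b = ψ (sw b.2 b.1, b.2) := fun ψ b => by
      simp [M, Matrix.mulVec, dotProduct]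
    have hMU : M ∈ Matrix.unitaryGroup _ ℂ :=
      involution_mem_unitaryGroup (σ := fun b : RobotBasis V m => (sw b.2 b.1, b.2))
        fun b => Prod.ext (hsw _ _) rfl
    have hML : IsCLocal G M := by
      let cls : RobotBasis V m → RobotBasis V m → Prop := fun a b =>
        a.2 = b.2 ∧ (b.1 = a.1 ∨ b.1 = sw a.2 a.1)
      refine ⟨⟨cls, ⟨fun a => ⟨rfl, Or.inl rfl⟩, ?_, ?_⟩⟩, ?_, ?_⟩
      · rintro ⟨v, z⟩ ⟨v', z'⟩ ⟨rfl : z = z', h | h⟩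
        · exact ⟨rfl, Or.inl h.symm⟩
        · refine ⟨rfl, Or.inr ?_⟩
          simp only at h ⊢
          rw [h, hsw]
      · rintro ⟨v, z⟩ ⟨v', z'⟩ ⟨v'', z''⟩ ⟨rfl : z = z', h | h⟩ ⟨rfl : z = z'', h' | h'⟩ <;>
          simp only at h h' <;> subst h <;> subst h'
        · exact ⟨rfl, Or.inl rfl⟩
        · exact ⟨rfl, Or.inr rfl⟩
        · exact ⟨rfl, Or.inr rfl⟩
        · exact ⟨rfl, Or.inl (hsw _ _)⟩
      · intro a b hab
        simp only [M, Matrix.of_apply]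
        rw [if_neg]
        rintro rfl
        exact hab ⟨rfl, Or.inr (hsw _ _).symm⟩
      · rintro ⟨v, z⟩
        cases h : dec z with
        | none =>
          refine ⟨v, v, Or.inl rfl, ?_⟩
          rintro b ⟨_, hb | hb⟩
          · exact Or.inl hb
          · left; simpa [sw, h] using hb
        | some w =>
          by_cases h1 : v = l () w
          · refine ⟨l () w, l' () w, hll () w, ?_⟩
            rintro b ⟨_, hb | hb⟩
            · exact Or.inl (hb.trans h1)
            · right; simpa [sw, h, h1] using hb
          by_cases h2 : v = l' () w
          · refine ⟨l () w, l' () w, hll () w, ?_⟩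
            rintro b ⟨_, hb | hb⟩
            · exact Or.inr (hb.trans h2)
            · left; simpa [sw, h, h2] using hb
          · refine ⟨v, v, Or.inl rfl, ?_⟩
            rintro b ⟨_, hb | hb⟩
            · exact Or.inl hb
            · left; simpa [sw, h, Equiv.swap_apply_of_ne_of_ne h1 h2] using hb
    refine ⟨[M, 1], rfl, ?_, fun X φ => ?_⟩
    · intro U hUL
      simp only [List.mem_cons, List.not_mem_nil, or_false] at hUL
      rcases hUL with rfl | rfl
      · exact ⟨hMU, hML⟩
      · exact ⟨one_mem _, isCLocal_one⟩
    · simp only [runSteps, Matrix.one_mulVec, oracleStep_oracleStep]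
      have key : ∀ (l : W → V) (φ : W → ℂ) (b : RobotBasis V m),
          (embMatrix (encodeBasis enc) *ᵥ locatedState l φ) b =
            ∑ w, if b = (l w, enc w) then φ w else 0 := by
        intro l φ b
        simp only [embMatrix, Matrix.mulVec, dotProduct, Matrix.of_apply, Fintype.sum_prod_type,
          locatedState]
        rw [Finset.sum_comm]
        simp only [Fintype.sum_bool]
        simp only [Bool.true_eq_false, and_false, if_false, mul_zero, Finset.sum_const_zero,
          zero_add, and_true]
        rw [Finset.sum_comm]
        refine Finset.sum_congr rfl fun w _ => ?_
        rw [Finset.sum_eq_single (l w)]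
        · have : encodeBasis enc (l w, false, w) = (l w, enc w) := by
            simp [encodeBasis, ← h0 w]
          simp [this]
        · intro v _ hv
          simp [hv]
        · simp
      funext ⟨v, z⟩
      rw [hMv, key, key]
      refine Finset.sum_congr rfl fun w _ => ?_
      congr 1
      simp only [Prod.mk.injEq, eq_iff_iff]
      refine and_congr_left fun hz => ?_
      have : sw z v = Equiv.swap (l () w) (l' () w) v := by simp [sw, hz, hdec]
      rw [this, Equiv.swap_apply_eq_iff, Equiv.swap_apply_left]
  | comp _ _ h1 h2 =>
    obtain ⟨L, hl, hL, hr⟩ := h1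
    obtain ⟨L', hl', hL', hr'⟩ := h2
    refine ⟨L ++ L', by simp [hl, hl'], fun U hU => ?_, fun X φ => ?_⟩
    · rcases List.mem_append.1 hU with h | h
      · exact hL U h
      · exact hL' U h
    · rw [runSteps_append, hr, hr', Matrix.mulVec_mulVec]

/-- The robot that performs the algorithm steps in a list. -/
noncomputable def QuantumRobot.ofList (L : List (Matrix (RobotBasis V m) (RobotBasis V m) ℂ))
    (hL : ∀ U ∈ L, U ∈ Matrix.unitaryGroup (RobotBasis V m) ℂ ∧ IsCLocal G U)
    (out : Fin (m + 1)) : QuantumRobot G where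
  extraBits := m
  step t := L.getD t 1
  unitary t := by
    rw [List.getD_eq_getElem?_getD]
    cases h : L[t]? with
    | none => exact one_mem _
    | some U => exact (hL U (List.mem_of_getElem? h)).1
  cLocal t := by
    rw [List.getD_eq_getElem?_getD]
    cases h : L[t]? with
    | none => exact isCLocal_one
    | some U => exact (hL U (List.mem_of_getElem? h)).2
  outBit := out

theorem QuantumRobot.state_ofList (L : List (Matrix (RobotBasis V m) (RobotBasis V m) ℂ))
    (hL : ∀ U ∈ L, U ∈ Matrix.unitaryGroup (RobotBasis V m) ℂ ∧ IsCLocal G U)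
    (out : Fin (m + 1)) (v₁ : V) (X : V → Bool) :
    (QuantumRobot.ofList L hL out).state v₁ X L.length =
      runSteps X L (Pi.single (v₁, fun _ => false) 1) := by
  have : ∀ t ≤ L.length, (QuantumRobot.ofList L hL out).state v₁ X t =
      runSteps X (L.take t) (Pi.single (v₁, fun _ => false) 1) := by
    intro t ht
    induction t with
    | zero => rfl
    | succ t ih =>
      rw [List.take_add_one, runSteps_append, ← ih (by omega), List.getElem?_eq_getElem ht]
      simp only [QuantumRobot.state, Option.toList_some, runSteps, QuantumRobot.ofList]
      rw [List.getD_eq_getElem _ _ ht]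
      rfl
  rw [this _ le_rfl, List.take_length]

theorem QuantumRobot.outProb_ofList (L : List (Matrix (RobotBasis V m) (RobotBasis V m) ℂ))
    (hL : ∀ U ∈ L, U ∈ Matrix.unitaryGroup (RobotBasis V m) ℂ ∧ IsCLocal G U)
    (out : Fin (m + 1)) (v₁ : V) (X : V → Bool) (b : Bool) :
    (QuantumRobot.ofList L hL out).outProb v₁ X L.length b =
      ∑ a : RobotBasis V m, if a.2 out = b then
        ‖runSteps X L (Pi.single (v₁, fun _ => false) 1) a‖ ^ 2 else 0 := by
  rw [← QuantumRobot.state_ofList L hL out]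
  rfl

end Robot

/-! ### Columns of unitary matrices and the uniform superposition. -/

section Unitary

variable {n : Type*} [Fintype n] [DecidableEq n]

theorem sum_norm_sq_col_of_mem_unitaryGroup {U : Matrix n n ℂ} (hU : U ∈ Matrix.unitaryGroup n ℂ)
    (j : n) : ∑ i, ‖U i j‖ ^ 2 = 1 := by
  have := congrFun (congrFun (Matrix.mem_unitaryGroup_iff'.1 hU) j) j
  simp only [Matrix.star_eq_conjTranspose, Matrix.mul_apply, Matrix.conjTranspose_apply,
    Matrix.one_apply_eq] at this
  have h2 : ∀ i, star (U i j) * U i j = ((‖U i j‖ ^ 2 : ℝ) : ℂ) := fun i => by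
    rw [Complex.star_def, Complex.conj_mul']; push_cast; rfl
  simp only [h2] at this
  exact_mod_cast this

/-- A unitary matrix one of whose columns is constant (a Householder reflection). -/
theorem exists_unitary_col_const (i₀ : n) :
    ∃ U ∈ Matrix.unitaryGroup n ℂ, ∀ i, U i i₀ = ((1 / Real.sqrt (Fintype.card n) : ℝ) : ℂ) := by
  have hN : (0 : ℝ) < Fintype.card n := by
    exact_mod_cast Fintype.card_pos_iff.2 ⟨i₀⟩
  set c : ℝ := 1 / Real.sqrt (Fintype.card n) with hc
  have hc2 : (Fintype.card n : ℝ) * c ^ 2 = 1 := by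
    rw [hc, div_pow, Real.sq_sqrt hN.le]; field_simp
  -- The reflection exchanges the basis vector of `i₀` with the uniform vector. If these coincide,
  -- the reflecting vector vanishes and the identity is used instead.
  by_cases h1 : c = 1
  · have hcard : Fintype.card n = 1 := by
      rw [h1] at hc2; simpa using hc2
    have : Subsingleton n := Fintype.card_le_one_iff_subsingleton.1 hcard.le
    refine ⟨1, one_mem _, fun i => ?_⟩
    rw [Subsingleton.elim i i₀, h1]; simp
  have h1' : (1 : ℂ) - c ≠ 0 := by
    intro h
    exact h1 (by exact_mod_cast (sub_eq_zero.1 h).symm)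
  have hc2' : (Fintype.card n : ℂ) * (c : ℂ) ^ 2 = 1 := by exact_mod_cast hc2
  let w : n → ℂ := fun i => (if i = i₀ then 1 else 0) - c
  have hw : ∑ i, w i * w i = 2 * (1 - c) := by
    simp only [w, sub_mul, mul_sub, Finset.sum_sub_distrib]
    simp only [mul_ite, mul_one, mul_zero, ite_mul, one_mul, zero_mul, Finset.sum_ite_eq',
      Finset.mem_univ, if_true, Finset.sum_const, Finset.card_univ, nsmul_eq_mul]
    linear_combination hc2'
  have hstar : ∀ i, star (w i) = w i := fun i => by
    simp only [w]; split_ifs <;> simp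
  let U : Matrix n n ℂ := 1 - (1 / (1 - c : ℂ)) • Matrix.vecMulVec w w
  have hUs : Uᴴ = U := by
    ext i j
    have h2 : star (1 / (1 - c : ℂ)) = 1 / (1 - c : ℂ) := by simp
    simp only [U, Matrix.conjTranspose_apply, Matrix.sub_apply, Matrix.smul_apply,
      Matrix.vecMulVec_apply, smul_eq_mul, star_sub, star_mul', h2, hstar, Matrix.one_apply,
      eq_comm (a := j)]
    split_ifs <;> simp [mul_comm]
  refine ⟨U, ?_, fun i => ?_⟩
  · apply unitary_of_mul_conjTranspose
    rw [hUs]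
    have hvv : Matrix.vecMulVec w w * Matrix.vecMulVec w w =
        (2 * (1 - c : ℂ)) • Matrix.vecMulVec w w := by
      ext i j
      simp only [Matrix.mul_apply, Matrix.vecMulVec_apply, Matrix.smul_apply, smul_eq_mul, ← hw,
        Finset.sum_mul]
      exact Finset.sum_congr rfl fun k _ => by ring
    have : 1 / (1 - c : ℂ) * (1 / (1 - c) * (2 * (1 - c))) = 1 / (1 - c) + 1 / (1 - c) := by
      field_simp; ring
    have h2 : (1 / (1 - c : ℂ)) • Matrix.vecMulVec w w * (1 / (1 - c : ℂ)) • Matrix.vecMulVec w w =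
        (1 / (1 - c : ℂ)) • Matrix.vecMulVec w w + (1 / (1 - c : ℂ)) • Matrix.vecMulVec w w := by
      rw [Matrix.smul_mul, Matrix.mul_smul, hvv, smul_smul, smul_smul, mul_assoc, this, add_smul]
    simp only [U, Matrix.sub_mul, Matrix.mul_sub, Matrix.one_mul, Matrix.mul_one, h2]
    abel
  · simp only [U, Matrix.sub_apply, Matrix.smul_apply, Matrix.vecMulVec_apply, smul_eq_mul,
      Matrix.one_apply, w, if_true]
    field_simp
    ring

end Unitary

/-! ### Procedures with a flag and one-sided error. -/

section FlagProcedure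

variable {V : Type*} {G : SimpleGraph V}

/-- There is a procedure of `T` robot steps that starts and ends at the vertex `v₁` and, on input
`X`, leaves its flag unset with probability `g X`. -/
def FlagProcedure (G : SimpleGraph V) (v₁ : V) (T : ℕ) (g : (V → Bool) → ℝ) : Prop :=
  ∃ (Q : Type) (_ : Fintype Q) (_ : DecidableEq Q) (q₀ : Q) (D : Q → Bool)
    (K : (V → Bool) → Unit → Matrix Q Q ℂ), D q₀ = false ∧
    Simulates G (fun _ _ => v₁) (fun _ _ => v₁) T K ∧
    ∀ X, ∑ q, (if D q then 0 else ‖K X () q q₀‖ ^ 2) = g X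

namespace FlagProcedure

variable {v₁ : V} {T T' : ℕ} {g g' : (V → Bool) → ℝ}

theorem nonneg (h : FlagProcedure G v₁ T g) (X : V → Bool) : 0 ≤ g X := by
  obtain ⟨Q, _, _, q₀, D, K, _, _, hg⟩ := h
  rw [← hg]
  exact Finset.sum_nonneg fun q _ => by split_ifs <;> positivity

theorem le_one (h : FlagProcedure G v₁ T g) (X : V → Bool) : g X ≤ 1 := by
  obtain ⟨Q, _, _, q₀, D, K, _, hK, hg⟩ := h
  rw [← hg, ← sum_norm_sq_col_of_mem_unitaryGroup (hK.mem_unitaryGroup X ()) q₀]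
  refine Finset.sum_le_sum fun q _ => ?_
  split_ifs
  · positivity
  · exact le_rfl

protected theorem one (G : SimpleGraph V) (v₁ : V) : FlagProcedure G v₁ 0 1 :=
  ⟨Unit, inferInstance, inferInstance, (), fun _ => false, fun _ _ => 1, rfl, Simulates.refl _,
    fun X => by simp⟩

/-- Performing two procedures with separate registers one after the other. -/
protected theorem mul (h : FlagProcedure G v₁ T g) (h' : FlagProcedure G v₁ T' g') :
    FlagProcedure G v₁ (T + T') (g * g') := by
  obtain ⟨Q, _, _, q₀, D, K, hD, hK, hg⟩ := h
  obtain ⟨Q', _, _, q₀', D', K', hD', hK', hg'⟩ := h'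
  have h1 := (hK.comap (fun _ : Unit × Q' => ())).blockDiagonal (Equiv.refl (Q × Q'))
  have h2 := (hK'.comap (fun _ : Unit × Q => ())).blockDiagonal (Equiv.prodComm Q Q')
  refine ⟨Q × Q', inferInstance, inferInstance, (q₀, q₀'), fun q => D q.1 || D' q.2, _,
    by simp [hD, hD'], h1.comp h2, fun X => ?_⟩
  have key : ∀ q, ((Matrix.blockDiagonal fun _ : Q => K' X ()).submatrix (Equiv.prodComm Q Q')
      (Equiv.prodComm Q Q') * (Matrix.blockDiagonal fun _ : Q' => K X ()).submatrix
      (Equiv.refl (Q × Q')) (Equiv.refl (Q × Q'))) q (q₀, q₀') =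
      K X () q.1 q₀ * K' X () q.2 q₀' := by
    rintro ⟨a, a'⟩
    rw [Matrix.mul_apply, Finset.sum_eq_single (a, q₀')]
    · simp [Matrix.blockDiagonal_apply, mul_comm]
    · rintro ⟨b, b'⟩ _ hb
      simp only [Matrix.submatrix_apply, Matrix.blockDiagonal_apply, Equiv.prodComm_apply,
        Prod.swap, Equiv.refl_apply]
      by_cases h1 : a = b
      · by_cases h2 : b' = q₀'
        · exact absurd (by rw [h1, h2]) hb
        · simp [h2]
      · simp [h1]
    · simp
  simp only [key, Pi.mul_apply, ← hg, ← hg', Finset.sum_mul_sum, Fintype.sum_prod_type]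
  refine Finset.sum_congr rfl fun a _ => Finset.sum_congr rfl fun b _ => ?_
  cases D a <;> cases D' b <;> simp [mul_pow]

protected theorem pow (h : FlagProcedure G v₁ T g) (N : ℕ) :
    FlagProcedure G v₁ (N * T) (g ^ N) := by
  induction N with
  | zero => simpa using FlagProcedure.one G v₁
  | succ N ih =>
    rw [pow_succ, Nat.succ_mul]
    exact ih.mul h

protected theorem prod {ι : Type*} (s : Finset ι) {t : ι → ℕ} {g : ι → (V → Bool) → ℝ}
    (h : ∀ i ∈ s, FlagProcedure G v₁ (t i) (g i)) :
    FlagProcedure G v₁ (∑ i ∈ s, t i) (∏ i ∈ s, g i) := by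
  classical
  induction s using Finset.induction_on with
  | empty => simpa using FlagProcedure.one G v₁
  | insert a s ha ih =>
    rw [Finset.sum_insert ha, Finset.prod_insert ha]
    exact (h a (Finset.mem_insert_self _ _)).mul
      (ih fun i hi => h i (Finset.mem_insert_of_mem hi))

/-- A procedure whose control register is chosen uniformly at random. -/
theorem of_control {Ω Y : Type} [Fintype Ω] [Nonempty Ω] [Fintype Y] [DecidableEq Y]
    {K : (V → Bool) → Ω → Matrix Y Y ℂ}
    (hK : Simulates G (fun _ _ => v₁) (fun _ _ => v₁) T K) (y₀ : Y) (D : Y → Bool)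
    (hD : D y₀ = false) :
    FlagProcedure G v₁ (2 + T) (fun X =>
      (∑ ω, ∑ y, (if D y then 0 else ‖K X ω y y₀‖ ^ 2)) / Fintype.card Ω) := by
  classical
  obtain ⟨ω₀⟩ := ‹Nonempty Ω›
  -- The superposition over controls is only read afterwards, so probabilities average over ω as for
  -- a classical random choice.
  obtain ⟨F, hF, hF0⟩ := exists_unitary_col_const ω₀
  have h1 : Simulates G (fun (_ : Unit × Y) (_ : Ω) => v₁) (fun _ _ => v₁) 2 (fun _ _ => F) :=
    Simulates.local_op _ _ (fun _ => hF) (fun _ _ _ _ => rfl)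
  have h2 := h1.blockDiagonal (Equiv.prodComm Y Ω)
  have h3 := (hK.comap (Prod.snd : Unit × Ω → Ω)).blockDiagonal (Equiv.refl (Y × Ω))
  refine ⟨Y × Ω, inferInstance, inferInstance, (y₀, ω₀), fun q => D q.1, _, hD, h2.comp h3,
    fun X => ?_⟩
  have key : ∀ q, ((Matrix.blockDiagonal (K X)).submatrix (Equiv.refl (Y × Ω))
      (Equiv.refl (Y × Ω)) * (Matrix.blockDiagonal fun _ : Y => F).submatrix
      (Equiv.prodComm Y Ω) (Equiv.prodComm Y Ω)) q (y₀, ω₀) =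
      K X q.2 q.1 y₀ * ((1 / Real.sqrt (Fintype.card Ω) : ℝ) : ℂ) := by
    rintro ⟨y, ω⟩
    rw [Matrix.mul_apply, Finset.sum_eq_single (y₀, ω)]
    · simp [Matrix.blockDiagonal_apply, hF0]
    · rintro ⟨b, b'⟩ _ hb
      simp only [Matrix.submatrix_apply, Matrix.blockDiagonal_apply, Equiv.prodComm_apply,
        Prod.swap, Equiv.refl_apply]
      by_cases h1 : b = y₀
      · by_cases h2 : ω = b'
        · exact absurd (by rw [h1, h2]) hb
        · simp [h2]
      · simp [h1]
    · simp
  have hc : ‖((1 / Real.sqrt (Fintype.card Ω) : ℝ) : ℂ)‖ ^ 2 = 1 / Fintype.card Ω := by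
    rw [Complex.norm_real, Real.norm_eq_abs, sq_abs, div_pow, Real.sq_sqrt (by positivity), one_pow]
  simp only [key, norm_mul, mul_pow, hc, Fintype.sum_prod_type]
  rw [Finset.sum_comm, Finset.sum_div]
  refine Finset.sum_congr rfl fun ω _ => ?_
  rw [Finset.sum_div]
  refine Finset.sum_congr rfl fun y _ => ?_
  split_ifs <;> simp [div_eq_mul_inv]

theorem robotComplexity_le [Fintype V] [DecidableEq V] (h : FlagProcedure G v₁ T g)
    {f : (V → Bool) → Option Bool} (hfalse : ∀ X, f X = some false → 2 / 3 ≤ g X)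
    (htrue : ∀ X, f X = some true → g X ≤ 1 / 3) : robotComplexity G v₁ f ≤ T := by
  obtain ⟨Q, _, _, q₀, D, K, hD, hK, hg⟩ := h
  refine sInf_le ⟨T, rfl, ?_⟩
  let e := Fintype.equivFin Q
  -- Bit 0 is the query bit and bit 1 the flag. The rest is a one-hot code of `q`, except that `q₀`
  -- gets all zeros, so that it encodes the initial state.
  let enc : Q → Fin (Fintype.card Q + 1 + 1) → Bool := fun q =>
    Fin.cons false (Fin.cons (D q) fun i => decide (e q = i ∧ q ≠ q₀))
  have henc0 : enc q₀ = fun _ => false := by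
    funext i
    refine Fin.cases rfl (fun i => ?_) i
    refine Fin.cases ?_ (fun i => ?_) i
    · simp [enc, hD]
    · simp [enc]
  have hinj : Function.Injective enc := by
    intro q q' hqq
    have h2 : ∀ i, (e q = i ∧ q ≠ q₀) ↔ (e q' = i ∧ q' ≠ q₀) := fun i => by
      have := congrFun hqq i.succ.succ
      simpa only [enc, Fin.cons_succ, decide_eq_decide] using this
    by_cases hq : q = q₀
    · by_cases hq' : q' = q₀
      · rw [hq, hq']
      · have := (h2 (e q')).2 ⟨rfl, hq'⟩
        exact absurd hq this.2
    · exact (e.injective ((h2 (e q)).1 ⟨rfl, hq⟩).1).symm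
  have h0 : ∀ q, enc q 0 = false := fun q => rfl
  obtain ⟨L, hlen, hL, hrun⟩ := hK.exists_steps hinj h0
  let S := fun X => runSteps X L (Pi.single (v₁, fun _ => false) 1)
  have hf := encodeBasis_injective (V := V) hinj h0
  have henc : ∀ q, encodeBasis enc (v₁, false, q) = (v₁, enc q) := fun q => by
    simp [encodeBasis, ← h0 q]
  have hstate : ∀ X a, S X a = ∑ q, if a = (v₁, enc q) then K X () q q₀ else 0 := by
    intro X a
    have hinit : (Pi.single (v₁, fun _ => false) 1 : RobotBasis V (Fintype.card Q + 1) → ℂ) =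
        embMatrix (encodeBasis enc) *ᵥ locatedState (fun _ => v₁) (Pi.single q₀ 1) := by
      funext b
      by_cases hb : ∃ a, encodeBasis enc a = b
      · obtain ⟨⟨v, x, q⟩, rfl⟩ := hb
        rw [embMatrix_mulVec_apply hf, ← henc0, ← henc]
        simp only [Pi.single_apply, hf.eq_iff, locatedState, Prod.mk.injEq]
        by_cases h1 : v = v₁ <;> by_cases h2 : x = false <;> simp [h1, h2]
      · push Not at hb
        rw [embMatrix_mulVec_apply_of_notMem _ hb, Pi.single_apply, if_neg]
        rintro rfl
        exact hb (v₁, false, q₀) (by rw [henc, henc0])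
    have : S X = embMatrix (encodeBasis enc) *ᵥ
        locatedState (fun _ => v₁) (fun q => K X () q q₀) := by
      simp only [S]
      rw [hinit, hrun]
      congr 2
      funext q
      simp
    rw [this]
    by_cases ha : ∃ q, a = (v₁, enc q)
    · obtain ⟨q, rfl⟩ := ha
      rw [← henc, embMatrix_mulVec_apply hf, Finset.sum_eq_single q]
      · rw [henc]; simp [locatedState]
      · intro q' _ hq'
        rw [if_neg]
        rw [← henc, hf.eq_iff]
        simpa using hq'.symm
      · simp
    · push Not at ha
      rw [Finset.sum_eq_zero fun q _ => if_neg (ha q)]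
      simp only [embMatrix, Matrix.mulVec, dotProduct, Matrix.of_apply]
      refine Finset.sum_eq_zero fun ⟨v, x, q⟩ _ => ?_
      by_cases h1 : v = v₁ ∧ x = false
      · obtain ⟨rfl, rfl⟩ := h1
        rw [henc, if_neg (ha q), zero_mul]
      · simp [locatedState, h1]
  have hout : ∀ X b, (QuantumRobot.ofList L hL 1).outProb v₁ X T b =
      ∑ q, if D q = b then ‖K X () q q₀‖ ^ 2 else 0 := by
    intro X b
    have hst : ∀ q, S X (v₁, enc q) = K X () q q₀ := fun q => by
      rw [hstate, Finset.sum_eq_single q]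
      · simp
      · intro q' _ hq'
        rw [if_neg]
        intro h
        exact hq' (hinj (Prod.mk.inj h).2).symm
      · simp
    have hinj' : Function.Injective fun q => ((v₁, enc q) : RobotBasis V (Fintype.card Q + 1)) :=
      fun q q' h => hinj (Prod.mk.inj h).2
    rw [← hlen, QuantumRobot.outProb_ofList, ← Finset.sum_subset (Finset.subset_univ
      (Finset.univ.map ⟨fun q => ((v₁, enc q) : RobotBasis V (Fintype.card Q + 1)), hinj'⟩)),
      Finset.sum_map]
    · exact Finset.sum_congr rfl fun q _ => by
        change (if D q = b then ‖S X (v₁, enc q)‖ ^ 2 else 0) = _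
        rw [hst]
    · intro a _ ha
      change (if a.2 1 = b then ‖S X a‖ ^ 2 else 0) = 0
      rw [hstate, Finset.sum_eq_zero]
      · simp
      · intro q _
        rw [if_neg]
        rintro rfl
        exact ha (by simp)
  refine ⟨QuantumRobot.ofList L hL 1, fun X b hX => ?_⟩
  rw [hout]
  cases b with
  | false =>
    refine (hfalse X hX).trans (le_of_eq ?_)
    rw [← hg]
    exact Finset.sum_congr rfl fun q _ => by cases D q <;> simp
  | true =>
    have h1 := htrue X hX
    have h2 := sum_norm_sq_col_of_mem_unitaryGroup (hK.mem_unitaryGroup X ()) q₀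
    have h3 : (∑ q, if D q = true then ‖K X () q q₀‖ ^ 2 else 0) + g X = 1 := by
      rw [← hg, ← h2, ← Finset.sum_add_distrib]
      exact Finset.sum_congr rfl fun q _ => by cases D q <;> simp
    linarith

end FlagProcedure

end FlagProcedure

/-! ### One round of amplitude amplification. -/

section Amplification

/-- The effect of one round of amplitude amplification on an amplitude: `sin θ ↦ sin (3 θ)`. -/
def sinTriple (a : ℝ) : ℝ := 3 * a - 4 * a ^ 3

variable {Y : Type*} [Fintype Y] [DecidableEq Y]

/-- One round of amplitude amplification turns an amplitude `α` into `3 α - 4 α ^ 3`. -/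
theorem amplification_apply {U : Matrix Y Y ℂ} (hU : U ∈ Matrix.unitaryGroup Y ℂ)
    (c : Y → Prop) [DecidablePred c] {z y : Y} (hy : c y) {s : ℝ}
    (hs : ∑ w, (if c w then ‖U z w‖ ^ 2 else 0) = s) :
    (U * Matrix.diagonal (fun w => if c w then 1 else -1) * Uᴴ *
      Matrix.diagonal (fun w => if w = z then -1 else 1) * U : Matrix Y Y ℂ) z y = (3 - 4 * s) * U z y := by
  set P : Matrix Y Y ℂ := Matrix.diagonal fun w => if c w then 1 else 0 with hP
  set E : Matrix Y Y ℂ := Matrix.single z z 1 with hE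
  have h1 : Matrix.diagonal (fun w => if c w then (1 : ℂ) else -1) = (2 : ℂ) • P - 1 := by
    ext i j
    by_cases h : i = j
    · subst h
      by_cases h' : c i
      · simp [hP, h']; norm_num
      · simp [hP, h']
    · simp [hP, h]
  have h2 : Matrix.diagonal (fun w => if w = z then (-1 : ℂ) else 1) = 1 - (2 : ℂ) • E := by
    ext i j
    by_cases h : i = j
    · subst h
      by_cases h' : i = z
      · subst h'
        simp [hE]; norm_num
      · simp [hE, h', Matrix.single_apply_of_ne, Ne.symm h']
    · have : ¬ (z = i ∧ z = j) := fun h' => h (h'.1.symm.trans h'.2)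
      simp [hE, h, this]
  have hUU : U * Uᴴ = 1 := Matrix.mem_unitaryGroup_iff.1 hU
  have hUU' : Uᴴ * U = 1 := Matrix.mem_unitaryGroup_iff'.1 hU
  -- At the entry (z, y) the four terms contribute 2, -1, 2 and -4s times `U z y`, in total 3 - 4s.
  have h3 : U * ((2 : ℂ) • P - 1) * Uᴴ * (1 - (2 : ℂ) • E) * U =
      (2 : ℂ) • (U * P) - U + (2 : ℂ) • (E * U) - (4 : ℂ) • (U * P * Uᴴ * (E * U)) := by
    have e1 : U * ((2 : ℂ) • P - 1) * Uᴴ = (2 : ℂ) • (U * P * Uᴴ) - 1 := by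
      rw [mul_sub, sub_mul, mul_one, hUU, Matrix.mul_smul, Matrix.smul_mul]
    have e2 : U * P * Uᴴ * U = U * P := by rw [mul_assoc, hUU', mul_one]
    rw [e1, mul_assoc, sub_mul, one_mul, sub_mul, one_mul, mul_sub, Matrix.smul_mul,
      Matrix.smul_mul, Matrix.smul_mul, e2, Matrix.mul_smul]
    module
  have hUP : (U * P) z y = U z y := by simp [hP, hy]
  have hEU : ∀ i, (E * U) i y = if i = z then U z y else 0 := fun i => by
    by_cases h : i = z
    · subst h; simp [hE]
    · simp [hE, h]
  have hs' : (U * P * Uᴴ) z z = s := by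
    rw [← hs, Matrix.mul_apply]
    push_cast
    refine Finset.sum_congr rfl fun w _ => ?_
    rw [Matrix.mul_diagonal, Matrix.conjTranspose_apply, Complex.star_def]
    split_ifs
    · rw [mul_one, Complex.mul_conj', Complex.ofReal_pow]
    · simp
  rw [h1, h2, h3]
  simp only [Matrix.sub_apply, Matrix.add_apply, Matrix.smul_apply, hUP, hEU, if_true]
  rw [Matrix.mul_apply, Finset.sum_eq_single z]
  · rw [hs', hEU, if_pos rfl]
    simp only [smul_eq_mul]
    ring
  · intro w _ hw
    rw [hEU, if_neg hw, mul_zero]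
  · simp

end Amplification

/-! ### Operators on a single digit. -/

section DigitOperator

variable {R : ℕ} {D : Type*} [Fintype D] [DecidableEq D]

/-- The operator `F`, applied to the digit `r`. -/
def digitOperator (r : Fin R) (F : Matrix D D ℂ) : Matrix (Fin R → D) (Fin R → D) ℂ :=
  (Matrix.blockDiagonal fun _ => F).submatrix (Equiv.funSplitAt r D) (Equiv.funSplitAt r D)

theorem digitOperator_mem_unitaryGroup (r : Fin R) {F : Matrix D D ℂ}
    (hF : F ∈ Matrix.unitaryGroup D ℂ) :
    digitOperator r F ∈ Matrix.unitaryGroup (Fin R → D) ℂ := by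
  rw [Matrix.mem_unitaryGroup_iff, Matrix.star_eq_conjTranspose, digitOperator,
    Matrix.conjTranspose_submatrix, Matrix.submatrix_mul_equiv,
    Matrix.blockDiagonal_conjTranspose, ← Matrix.blockDiagonal_mul]
  have h1 : F * Fᴴ = 1 := Matrix.mem_unitaryGroup_iff.1 hF
  have : (fun _ : {j // j ≠ r} → D => (1 : Matrix D D ℂ)) = 1 := rfl
  simp only [h1]
  rw [this, Matrix.blockDiagonal_one, Matrix.submatrix_one_equiv]

theorem digitOperator_apply_ne_zero {r : Fin R} {F : Matrix D D ℂ} {y' y : Fin R → D}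
    (h : digitOperator r F y' y ≠ 0) (i : Fin R) (hi : i ≠ r) : y' i = y i := by
  simp only [digitOperator, Matrix.submatrix_apply, Matrix.blockDiagonal_apply] at h
  split_ifs at h with h'
  · exact congrFun h' ⟨i, hi⟩
  · exact absurd rfl h

theorem mul_digitOperator_apply (r : Fin R) (F : Matrix D D ℂ)
    (U : Matrix (Fin R → D) (Fin R → D) ℂ) (z y : Fin R → D) :
    (U * digitOperator r F) z y = ∑ c, U z (Function.update y r c) * F c (y r) := by
  rw [Matrix.mul_apply, ← (Equiv.funSplitAt r D).symm.sum_comp, Fintype.sum_prod_type]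
  refine Finset.sum_congr rfl fun c _ => ?_
  rw [Finset.sum_eq_single (s := Finset.univ) (fun j : {j // j ≠ r} => y j)]
  · have : (Equiv.funSplitAt r D).symm (c, fun j => y j) = Function.update y r c := by
      funext i
      by_cases hi : i = r
      · subst hi; simp
      · simp [hi]
    rw [this]
    congr 1
    simp [digitOperator, Matrix.blockDiagonal_apply]
    intro h
    exact absurd (funext fun j => by simp [j.2]) h
  · intro w _ hw
    simp only [digitOperator, Matrix.submatrix_apply, Equiv.apply_symm_apply,
      Matrix.blockDiagonal_apply]
    rw [if_neg, mul_zero]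
    exact hw
  · simp

end DigitOperator

/-! ### Nested search for a unique marked item. -/

section Search

variable {V : Type*} {G : SimpleGraph V} {Ω : Type} {R : ℕ} {D : Type} [Fintype D] [DecidableEq D]
  [Zero D] {loc : (Fin R → D) → V} {pt : Ω → (Fin R → D) → V} {act : Ω → (Fin R → D) → Bool}

/-- The item `y` is marked if it is active and its point is marked. -/
def itemMarked (pt : Ω → (Fin R → D) → V) (act : Ω → (Fin R → D) → Bool) (X : V → Bool) (ω : Ω)
    (y : Fin R → D) : Bool :=
  act ω y && X (pt ω y)

/-- With `T` robot steps one can, starting from an item all of whose digits of index less than `r`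
are zero, arrive with amplitude `α` at the marked item, if that is unique and agrees with the given
item in the digits of index at least `r`. -/
def HasSearch (G : SimpleGraph V) (loc : (Fin R → D) → V) (pt : Ω → (Fin R → D) → V)
    (act : Ω → (Fin R → D) → Bool) (r T : ℕ) (α : ℝ) : Prop :=
  ∃ K : (V → Bool) → Ω → Matrix (Fin R → D) (Fin R → D) ℂ,
    Simulates G (fun _ => loc) (fun _ => loc) T K ∧
    ∀ X ω z, (∀ y, itemMarked pt act X ω y = true ↔ y = z) →
      ∀ y : Fin R → D, (∀ i, i.val < r → y i = 0) →
        K X ω z y = if ∀ i, r ≤ i.val → y i = z i then (α : ℂ) else 0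

theorem HasSearch.zero : HasSearch G loc pt act 0 0 1 := by
  refine ⟨fun _ _ => 1, Simulates.refl _, fun X ω z _ y _ => ?_⟩
  by_cases h : z = y
  · subst h; simp
  · change (1 : Matrix _ _ ℂ) z y = _
    rw [Matrix.one_apply_ne h, if_neg]
    exact fun h' => h (funext fun i => (h' i (Nat.zero_le _)).symm)

/-- The reflection is about the span of all items whose low digits vanish, so it needs no knowledge
of the high digits. Within this span only the ancestor of the target reaches the target, with weight
α², so one map 3α - 4α³ serves all starting items. The cost is three searches, a phase query with
its walks, and a local reflection. -/
theorem HasSearch.amplify {r T m : ℕ} {α : ℝ} (h : HasSearch G loc pt act r T α)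
    (hm : ∀ ω y, ∃ p : G.Walk (loc y) (pt ω y), p.length ≤ m) :
    HasSearch G loc pt act r (3 * T + (4 * m + 4)) (sinTriple α) := by
  obtain ⟨K, hK, hα⟩ := h
  have hdiag : ∀ f : (Fin R → D) → Bool,
      Matrix.diagonal (fun y => if f y then (-1 : ℂ) else 1) ∈ Matrix.unitaryGroup _ ℂ := by
    intro f
    rw [Matrix.mem_unitaryGroup_iff, Matrix.star_eq_conjTranspose, Matrix.diagonal_conjTranspose,
      Matrix.diagonal_mul_diagonal, ← Matrix.diagonal_one]
    congr 1
    funext y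
    cases h : f y <;> simp [h]
  have hne : ∀ (f : (Fin R → D) → ℂ) y y', Matrix.diagonal f y' y ≠ 0 → y' = y := by
    intro f y y' h
    by_contra hc
    exact h (Matrix.diagonal_apply_ne _ hc)
  have hX : Simulates G (fun _ => loc) (fun _ => loc) (2 + 4 * m)
      (fun X ω => Matrix.diagonal fun y => if itemMarked pt act X ω y then (-1 : ℂ) else 1) := by
    refine ((Simulates.query pt
      (fun ω x => Matrix.diagonal fun y => if act ω y && x then (-1 : ℂ) else 1)
      (fun ω x => hdiag _) (fun ω x y y' h => by rw [hne _ _ _ h])).conj_walk m hm).congr rfl ?_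
    intro X ω
    ext y' y
    by_cases h : y' = y
    · subst h
      simp [queryMatrix, itemMarked]
    · simp [queryMatrix, h]
  have h0 : Simulates G (fun _ : Ω => loc) (fun _ => loc) 2 (fun _ _ => Matrix.diagonal
      fun y => if ∀ i : Fin R, i.val < r → y i = 0 then (1 : ℂ) else -1) := by
    refine Simulates.local_op _ _ (fun ω => ?_) (fun ω y y' h => by rw [hne _ _ _ h])
    refine (congrArg (· ∈ Matrix.unitaryGroup _ ℂ) (congrArg Matrix.diagonal (funext fun y => ?_))).mp
      (hdiag fun y => !decide (∀ i : Fin R, i.val < r → y i = 0))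
    by_cases h : ∀ i : Fin R, i.val < r → y i = 0
    · rw [if_pos h, if_neg (by rw [decide_eq_true h]; decide)]
    · rw [if_neg h, if_pos (by rw [decide_eq_false h]; rfl)]
  refine ⟨_, (((hK.comp hX).comp hK.adjoint).comp (h0.comp hK)).congr (by ring) fun _ _ => rfl,
    fun X ω z hz y hy => ?_⟩
  have hs : ∑ w, (if ∀ i : Fin R, i.val < r → w i = 0 then ‖K X ω z w‖ ^ 2 else 0) = α ^ 2 := by
    rw [Finset.sum_eq_single fun i => if i.val < r then 0 else z i]
    · rw [if_pos fun i hi => by simp [hi], hα X ω z hz _ fun i hi => by simp [hi],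
        if_pos fun i hi => by simp [hi], Complex.norm_real, Real.norm_eq_abs, sq_abs]
    · intro w _ hw
      by_cases hc : ∀ i : Fin R, i.val < r → w i = 0
      · rw [if_pos hc, hα X ω z hz _ hc, if_neg]
        · simp
        · intro hag
          apply hw
          funext i
          by_cases hi : i.val < r
          · simp [hi, hc i hi]
          · simp [hi, hag i (not_lt.1 hi)]
      · rw [if_neg hc]
    · simp
  have key := amplification_apply (hK.mem_unitaryGroup X ω)
    (fun w : Fin R → D => ∀ i, i.val < r → w i = 0) hy hs
  have hm' : (Matrix.diagonal fun y => if itemMarked pt act X ω y then (-1 : ℂ) else 1) =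
      Matrix.diagonal fun w => if w = z then -1 else 1 := by
    congr 1
    funext w
    simp only [hz]
  simp only [hm']
  simp only [← Matrix.mul_assoc]
  rw [key, hα X ω z hz y hy]
  split_ifs
  · rw [sinTriple]; push_cast; ring
  · simp

theorem HasSearch.amplify_iterate {r T m : ℕ} {α : ℝ} (h : HasSearch G loc pt act r T α)
    (hm : ∀ ω y, ∃ p : G.Walk (loc y) (pt ω y), p.length ≤ m) (t : ℕ) :
    ∃ T' ≤ 3 ^ t * (T + (2 * m + 2)),
      HasSearch G loc pt act r T' (sinTriple^[t] α) := by
  -- The shift by `2 * m + 2` makes the recursion 3T + 4m + 4 purely multiplicative.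
  suffices ∃ T', T' + (2 * m + 2) = 3 ^ t * (T + (2 * m + 2)) ∧
      HasSearch G loc pt act r T' (sinTriple^[t] α) by
    obtain ⟨T', h1, h2⟩ := this
    exact ⟨T', by omega, h2⟩
  induction t with
  | zero => exact ⟨T, by simp, h⟩
  | succ t ih =>
    obtain ⟨T', h1, h2⟩ := ih
    refine ⟨_, ?_, by rw [Function.iterate_succ_apply']; exact h2.amplify hm⟩
    rw [pow_succ, mul_assoc, mul_left_comm, ← h1]
    ring

/-- Changing digit `r` would change the location. The robot therefore first walks to where digit `r`
is zero, a place independent of that digit, and there the digit operator is local. Of its |D|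
branches only the one with the digit of the target contributes. -/
theorem HasSearch.succ {r : Fin R} {T w : ℕ} {α : ℝ} (h : HasSearch G loc pt act r T α)
    (hw : ∀ y, ∃ p : G.Walk (loc y) (loc (Function.update y r 0)), p.length ≤ w) :
    HasSearch G loc pt act (r + 1) (T + (4 * w + 2)) (α / Real.sqrt (Fintype.card D)) := by
  obtain ⟨K, hK, hα⟩ := h
  obtain ⟨F, hF, hF0⟩ := exists_unitary_col_const (0 : D)
  have hD : Simulates G (fun _ : Ω => loc) (fun _ => loc) (2 + 4 * w)
      (fun _ _ => digitOperator r F) := by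
    refine (Simulates.local_op (fun _ y => loc (Function.update y r 0)) _
      (fun _ => digitOperator_mem_unitaryGroup r hF) fun ω y y' hne => ?_).conj_walk w
      (fun _ => hw)
    congr 1
    funext i
    by_cases hi : i = r
    · subst hi; simp
    · simp [hi, digitOperator_apply_ne_zero hne i hi]
  refine ⟨_, (hD.comp hK).congr (by ring) fun _ _ => rfl, fun X ω z hz y hy => ?_⟩
  have hc : ∀ c, ∀ i : Fin R, i.val < r.val → Function.update y r c i = 0 := by
    intro c i hi
    rw [Function.update_of_ne (fun e => by simp [e] at hi)]
    exact hy i (by omega)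
  rw [mul_digitOperator_apply]
  simp only [hy r (Nat.lt_succ_self _), hF0, hα X ω z hz _ (hc _)]
  by_cases hag : ∀ i : Fin R, r.val + 1 ≤ i.val → y i = z i
  · rw [if_pos hag, Finset.sum_eq_single (z r)]
    · rw [if_pos]
      · push_cast; ring
      · intro i hi
        by_cases hir : i = r
        · subst hir; simp
        · rw [Function.update_of_ne hir]
          exact hag i (by have : i.val ≠ r.val := fun e => hir (Fin.ext e)
                          omega)
    · intro c _ hcz
      rw [if_neg, zero_mul]
      intro h'
      exact hcz (by simpa using h' r le_rfl)
    · simp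
  · rw [if_neg hag]
    refine Finset.sum_eq_zero fun c _ => ?_
    rw [if_neg, zero_mul]
    intro h'
    apply hag
    intro i hi
    have := h' i (by omega)
    rwa [Function.update_of_ne (fun e => by simp [e] at hi)] at this

/-- The flag is set by a fresh query after the search, so it cannot be set on the empty input,
whatever the search did. Only controls with a unique marked item are credited, each with α². -/
theorem HasSearch.flagProcedure [Fintype Ω] [Nonempty Ω] {T m M : ℕ} {α : ℝ}
    (h : HasSearch G loc pt act R T α)
    (hm : ∀ ω y, ∃ p : G.Walk (loc y) (pt ω y), p.length ≤ m) (v₁ : V)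
    (hM : ∀ y, ∃ p : G.Walk v₁ (loc y), p.length ≤ M) :
    ∃ g, FlagProcedure G v₁ (T + 4 * m + 4 * M + 4) g ∧ g (fun _ => false) = 1 ∧
      ∀ X, g X ≤ 1 - α ^ 2 * ((Finset.univ.filter fun ω =>
        ∃ z, ∀ y, itemMarked pt act X ω y = true ↔ y = z).card / Fintype.card Ω) := by
  classical
  obtain ⟨K, hK, hα⟩ := h
  have h1 := (hK.comap (Prod.fst : Ω × Bool → Ω)).blockDiagonal (Equiv.refl ((Fin R → D) × Bool))
  have h2 : Simulates G (fun (_ : Ω) (w : (Fin R → D) × Bool) => loc w.1) (fun _ w => loc w.1)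
      (2 + 4 * m) (fun X ω => Matrix.of fun b a =>
        if a = (b.1, xor b.2 (itemMarked pt act X ω b.1)) then (1 : ℂ) else 0) := by
    refine ((Simulates.query (fun ω w => pt ω w.1) (fun ω x => Matrix.of fun b a =>
        if a = (b.1, xor b.2 (act ω b.1 && x)) then (1 : ℂ) else 0)
        (fun ω x => ?_) (fun ω x y y' h => ?_)).conj_walk m (fun ω w => hm ω w.1)).congr rfl ?_
    · exact involution_mem_unitaryGroup
        (σ := fun b : (Fin R → D) × Bool => (b.1, xor b.2 (act ω b.1 && x))) fun b => by simp
    · simp only [Matrix.of_apply, ne_eq, ite_eq_right_iff, one_ne_zero, imp_false, not_not] at h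
      rw [h]
    · intro X ω
      ext b a
      simp only [queryMatrix, Matrix.of_apply, itemMarked]
      by_cases hab : a.1 = b.1
      · simp only [hab]
        congr
      · have : ∀ f, a ≠ (b.1, f) := fun f e => hab (by rw [e])
        simp [this]
  have h3 := (h1.comp h2).conj_walk (loc := fun _ _ => v₁) M (fun ω w => hM w.1)
  have h4 := FlagProcedure.of_control h3 ((0 : Fin R → D), false) Prod.snd rfl
  have hentry : ∀ X ω y f, ((Matrix.of fun (b a : (Fin R → D) × Bool) =>
      if a = (b.1, xor b.2 (itemMarked pt act X ω b.1)) then (1 : ℂ) else 0) *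
      (Matrix.blockDiagonal fun _ : Bool => K X ω).submatrix (Equiv.refl ((Fin R → D) × Bool))
        (Equiv.refl ((Fin R → D) × Bool)) : Matrix _ _ ℂ) (y, f) (0, false) =
      if f = itemMarked pt act X ω y then K X ω y 0 else 0 := by
    intro X ω y f
    rw [Matrix.mul_apply]
    simp only [Matrix.of_apply, ite_mul, one_mul, zero_mul, Finset.sum_ite_eq', Finset.mem_univ,
      if_true, Matrix.submatrix_apply, Equiv.refl_apply, Matrix.blockDiagonal_apply]
    cases f <;> cases itemMarked pt act X ω y <;> simp
  have hfail : ∀ X ω, (∑ b : (Fin R → D) × Bool, if b.2 = true then (0 : ℝ) else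
      ‖((Matrix.of fun (b a : (Fin R → D) × Bool) =>
        if a = (b.1, xor b.2 (itemMarked pt act X ω b.1)) then (1 : ℂ) else 0) *
      (Matrix.blockDiagonal fun _ : Bool => K X ω).submatrix (Equiv.refl ((Fin R → D) × Bool))
        (Equiv.refl ((Fin R → D) × Bool)) : Matrix _ _ ℂ) b (0, false)‖ ^ 2) =
      ∑ y, if itemMarked pt act X ω y then 0 else ‖K X ω y 0‖ ^ 2 := by
    intro X ω
    rw [Fintype.sum_prod_type]
    refine Finset.sum_congr rfl fun y _ => ?_
    simp only [hentry, Fintype.sum_bool]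
    cases itemMarked pt act X ω y <;> simp
  have hone : ∀ X ω, ∑ y, ‖K X ω y 0‖ ^ 2 = 1 := fun X ω =>
    sum_norm_sq_col_of_mem_unitaryGroup (hK.mem_unitaryGroup X ω) 0
  have hcard : (0 : ℝ) < Fintype.card Ω := by exact_mod_cast Fintype.card_pos
  have hT : 2 + (T + (2 + 4 * m) + 4 * M) = T + 4 * m + 4 * M + 4 := by ring
  rw [hT] at h4
  refine ⟨_, h4, ?_, fun X => ?_⟩
  · have hfalse : ∀ ω y, itemMarked pt act (fun _ => false) ω y = false := fun ω y => by
      simp [itemMarked]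
    simp only [hfail]
    simp only [hfalse, Bool.false_eq_true, if_false, hone]
    simp [hcard.ne']
  · simp only [hfail]
    rw [div_le_iff₀ hcard, sub_mul, mul_assoc, div_mul_cancel₀ _ hcard.ne', one_mul]
    have hω : ∀ ω, (∑ y, if itemMarked pt act X ω y then 0 else ‖K X ω y 0‖ ^ 2) ≤
        1 - α ^ 2 * (if ∃ z, ∀ y, itemMarked pt act X ω y = true ↔ y = z then 1 else 0) := by
      intro ω
      split_ifs with hz
      · obtain ⟨z, hz⟩ := hz
        have h5 : ‖K X ω z 0‖ ^ 2 = α ^ 2 := by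
          rw [hα X ω z hz 0 (fun _ _ => rfl), if_pos (fun i hi => absurd i.2 (not_lt.2 hi)),
            Complex.norm_real, Real.norm_eq_abs, sq_abs]
        have h6 := hone X ω
        rw [← Finset.add_sum_erase _ _ (Finset.mem_univ z), h5] at h6
        rw [← Finset.add_sum_erase _ _ (Finset.mem_univ z), if_pos ((hz z).2 rfl), zero_add,
          mul_one, ← h6, add_sub_cancel_left]
        refine Finset.sum_le_sum fun y _ => ?_
        split_ifs
        · positivity
        · exact le_rfl
      · rw [mul_zero, sub_zero, ← hone X ω]
        refine Finset.sum_le_sum fun y _ => ?_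
        split_ifs
        · positivity
        · exact le_rfl
    refine (Finset.sum_le_sum fun ω _ => hω ω).trans (le_of_eq ?_)
    rw [Finset.sum_sub_distrib, ← Finset.mul_sum, Finset.sum_boole]
    simp

end Search

/-! ### One random point per cell. -/

section RandomPoints

variable {Y O : Type*} [Fintype Y] [DecidableEq Y] [Fintype O] [DecidableEq O]

theorem card_filter_forall_eq (S : Finset Y) (o : Y → O) :
    ((Finset.univ.filter fun ω : Y → O => ∀ y ∈ S, ω y = o y).card : ℝ) *
      (Fintype.card O : ℝ) ^ S.card = Fintype.card (Y → O) := by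
  have h1 : (Finset.univ.filter fun ω : Y → O => ∀ y ∈ S, ω y = o y) =
      Fintype.piFinset fun y => if y ∈ S then {o y} else Finset.univ := by
    ext ω
    simp only [Finset.mem_filter, Finset.mem_univ, true_and, Fintype.mem_piFinset]
    refine forall_congr' fun y => ?_
    split_ifs with h <;> simp [h]
  have h2 : ∀ y, (if y ∈ S then ({o y} : Finset O) else Finset.univ).card =
      if y ∈ S then 1 else Fintype.card O := fun y => by
    split_ifs <;> simp
  have h3 : ∏ y, (if y ∈ S then Fintype.card O else 1) = Fintype.card O ^ S.card := by
    rw [Finset.prod_ite_mem, Finset.univ_inter, Finset.prod_const]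
  have h4 : (∏ y, if y ∈ S then 1 else Fintype.card O) * Fintype.card O ^ S.card =
      Fintype.card O ^ Fintype.card Y := by
    rw [← h3, ← Finset.prod_mul_distrib, ← Finset.card_univ (α := Y), ← Finset.prod_const]
    exact Finset.prod_congr rfl fun y _ => by split_ifs <;> simp
  rw [h1, Fintype.card_piFinset, Fintype.card_fun]
  simp only [h2]
  exact_mod_cast h4

/-- If one offset is chosen at random in each cell, then exactly one of the elements of `M` is
chosen with probability at least `μ (1 - μ)`, for the expected number `μ` of chosen elements. -/
theorem le_card_filter_card_eq_one {V : Type*} [DecidableEq V] [Nonempty O] (cell : V → Y)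
    (off : V → O) (hinj : ∀ v v', cell v = cell v' → off v = off v' → v = v') (M : Finset V) :
    (M.card / Fintype.card O : ℝ) * (1 - M.card / Fintype.card O) ≤
      (Finset.univ.filter fun ω : Y → O =>
        (M.filter fun v => ω (cell v) = off v).card = 1).card / Fintype.card (Y → O) := by
  set N : ℝ := ((Fintype.card O : ℕ) : ℝ) with hN
  have hNpos : 0 < N := by rw [hN]; exact_mod_cast Fintype.card_pos
  set W : ℝ := ((Fintype.card (Y → O) : ℕ) : ℝ) with hW
  have hWpos : 0 < W := by rw [hW]; exact_mod_cast Fintype.card_pos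
  set A : (Y → O) → ℝ := fun ω => (M.filter fun v => ω (cell v) = off v).card with hA
  have hAsum : ∀ ω, A ω = ∑ v ∈ M, if ω (cell v) = off v then 1 else 0 := fun ω => by
    simp [hA]
  have h1 : ∀ v, ∑ ω : Y → O, (if ω (cell v) = off v then (1 : ℝ) else 0) = W / N := fun v => by
    rw [eq_div_iff hNpos.ne', hW, ← card_filter_forall_eq {cell v} fun _ => off v]
    simp [hN]
  have h2 : ∀ v v', v ≠ v' → ∑ ω : Y → O, ((if ω (cell v) = off v then (1 : ℝ) else 0) *
      (if ω (cell v') = off v' then (1 : ℝ) else 0)) ≤ W / N ^ 2 := fun v v' hne => by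
    -- Two points of one cell exclude each other; points of different cells are independent.
    by_cases hc : cell v = cell v'
    · rw [Finset.sum_eq_zero]
      · positivity
      · intro ω _
        by_cases h : ω (cell v) = off v
        · rw [if_neg (c := ω (cell v') = off v'), mul_zero]
          intro h'
          exact hne (hinj v v' hc (by rw [← h, ← h', hc]))
        · rw [if_neg h, zero_mul]
    · apply le_of_eq
      rw [eq_div_iff (by positivity), hW, ← card_filter_forall_eq {cell v, cell v'}
        fun y => if y = cell v then off v else off v', Finset.card_pair hc]
      congr 1
      simp only [Finset.mem_insert, Finset.mem_singleton, forall_eq_or_imp, forall_eq, if_true,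
        if_neg (Ne.symm hc)]
      rw [← Finset.sum_boole]
      refine Finset.sum_congr rfl fun ω _ => ?_
      by_cases h : ω (cell v) = off v <;> simp [h]
  have hS1 : ∑ ω, A ω = M.card * (W / N) := by
    simp only [hAsum]
    rw [Finset.sum_comm, Finset.sum_congr rfl fun v _ => h1 v, Finset.sum_const, nsmul_eq_mul]
  have hS2 : ∑ ω, A ω ^ 2 ≤ M.card * (W / N) + M.card ^ 2 * (W / N ^ 2) := by
    have : ∑ ω, A ω ^ 2 = ∑ v ∈ M, ∑ v' ∈ M, ∑ ω : Y → O,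
        ((if ω (cell v) = off v then (1 : ℝ) else 0) *
          (if ω (cell v') = off v' then (1 : ℝ) else 0)) := by
      simp only [hAsum, sq, Finset.sum_mul_sum]
      rw [Finset.sum_comm]
      exact Finset.sum_congr rfl fun v _ => Finset.sum_comm
    rw [this]
    calc _ ≤ ∑ v ∈ M, ∑ v' ∈ M, ((if v = v' then W / N else 0) + W / N ^ 2) := by
          refine Finset.sum_le_sum fun v _ => Finset.sum_le_sum fun v' _ => ?_
          by_cases h : v = v'
          · subst h
            simp only [if_true, mul_ite, mul_one, mul_zero]
            have := h1 v
            have h3 : ∀ ω : Y → O, (if ω (cell v) = off v then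
              (if ω (cell v) = off v then (1 : ℝ) else 0) else 0) =
              if ω (cell v) = off v then 1 else 0 := fun ω => by split_ifs <;> rfl
            simp only [h3, this]
            have : 0 ≤ W / N ^ 2 := by positivity
            linarith
          · rw [if_neg h, zero_add]
            exact h2 v v' h
      _ = _ := by
          simp only [Finset.sum_add_distrib, Finset.sum_ite_eq, Finset.sum_const, nsmul_eq_mul]
          rw [Finset.sum_congr rfl (g := fun _ => W / N) fun v hv => if_pos hv, Finset.sum_const,
            nsmul_eq_mul]
          ring
  -- Since 2A - A² is at most the indicator of A = 1, two moments suffice: 2μ - (μ + μ²) = μ(1 - μ).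
  have hle : ∀ ω, 2 * A ω - A ω ^ 2 ≤
      if (M.filter fun v => ω (cell v) = off v).card = 1 then 1 else 0 := by
    intro ω
    simp only [hA]
    generalize (M.filter fun v => ω (cell v) = off v).card = a
    rcases a with _ | _ | a
    · simp
    · norm_num
    · rw [if_neg (by omega)]
      push_cast
      nlinarith [(Nat.cast_nonneg a : (0 : ℝ) ≤ a)]
  have htot := Finset.sum_le_sum fun ω (_ : ω ∈ Finset.univ) => hle ω
  rw [Finset.sum_sub_distrib, ← Finset.mul_sum, hS1, Finset.sum_boole] at htot
  rw [le_div_iff₀ hWpos]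
  refine le_trans ?_ htot
  have e1 : (M.card : ℝ) * (W / N) = M.card / N * W := by ring
  have e2 : (M.card : ℝ) ^ 2 * (W / N ^ 2) = (M.card / N) ^ 2 * W := by ring
  rw [e1, e2] at hS2
  rw [e1]
  nlinarith

end RandomPoints

/-! ### Walks and nested cubes in the grid. -/

section Grid

variable {d ℓ : ℕ}

theorem gridGraph_exists_walk_of_sum_le (L : ℕ) (u v : Fin d → Fin ℓ)
    (h : ∑ j, ((u j : ℕ) - v j + (v j - u j)) ≤ L) :
    ∃ p : (gridGraph d ℓ).Walk u v, p.length ≤ L := by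
  induction L generalizing u with
  | zero =>
    have : u = v := by
      funext j
      have := Finset.sum_eq_zero_iff.1 (Nat.le_zero.1 h) j (Finset.mem_univ j)
      exact Fin.ext (by omega)
    subst this
    exact ⟨.nil, le_rfl⟩
  | succ L ih =>
    by_cases huv : u = v
    · subst huv
      exact ⟨.nil, Nat.zero_le _⟩
    obtain ⟨j, hj⟩ := Function.ne_iff.1 huv
    have hj' : (u j : ℕ) ≠ v j := fun e => hj (Fin.ext e)
    obtain ⟨x, hx, hx'⟩ : ∃ x : Fin ℓ, ((u j : ℕ) + 1 = x ∨ (x : ℕ) + 1 = u j) ∧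
        (x : ℕ) - v j + (v j - x) < (u j : ℕ) - v j + (v j - u j) := by
      rcases lt_or_gt_of_ne hj' with hlt | hlt
      · exact ⟨⟨u j + 1, by have := (v j).2; omega⟩, Or.inl rfl, by simp only; omega⟩
      · exact ⟨⟨u j - 1, by have := (u j).2; omega⟩, Or.inr (by simp only; omega),
          by simp only; omega⟩
    have hadj : (gridGraph d ℓ).Adj u (Function.update u j x) :=
      ⟨j, fun i hi => by simp [hi], by simpa using hx⟩
    obtain ⟨p, hp⟩ := ih (Function.update u j x) <| by
      have : ∑ i, ((Function.update u j x i : ℕ) - v i + (v i - Function.update u j x i)) <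
          ∑ i, ((u i : ℕ) - v i + (v i - u i)) := by
        refine Finset.sum_lt_sum (fun i _ => ?_) ⟨j, Finset.mem_univ j, by simpa using hx'⟩
        by_cases hi : i = j
        · subst hi; simpa using hx'.le
        · simp [hi]
      omega
    exact ⟨.cons hadj p, by simpa using hp⟩

theorem gridGraph_exists_walk (w : ℕ) (u v : Fin d → Fin ℓ)
    (h : ∀ j, (u j : ℕ) ≤ v j + w ∧ (v j : ℕ) ≤ u j + w) :
    ∃ p : (gridGraph d ℓ).Walk u v, p.length ≤ d * w := by
  refine gridGraph_exists_walk_of_sum_le _ u v ?_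
  calc _ ≤ ∑ _j : Fin d, w := Finset.sum_le_sum fun j _ => by have := h j; omega
    _ = d * w := by simp

/-- The grid as a hierarchy of cubes, whose smallest cells of side `s` each have one random active
point. -/
theorem exists_grid_hierarchy (d : ℕ) {ℓ b s R : ℕ} [NeZero b] (hℓ : 0 < ℓ) (hs : 0 < s)
    (hR : ℓ ≤ s * b ^ R) :
    ∃ (Ω : Type) (_ : Fintype Ω) (_ : Nonempty Ω) (loc : (Fin R → Fin d → Fin b) → Fin d → Fin ℓ)
      (pt : Ω → (Fin R → Fin d → Fin b) → Fin d → Fin ℓ)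
      (act : Ω → (Fin R → Fin d → Fin b) → Bool),
      (∀ ω y, ∃ p : (gridGraph d ℓ).Walk (loc y) (pt ω y), p.length ≤ d * s) ∧
      (∀ (r : Fin R) y, ∃ p : (gridGraph d ℓ).Walk (loc y) (loc (Function.update y r 0)),
        p.length ≤ d * (s * b ^ (r.val + 1))) ∧
      (∀ v y, ∃ p : (gridGraph d ℓ).Walk v (loc y), p.length ≤ d * ℓ) ∧
      ∀ X : (Fin d → Fin ℓ) → Bool,
        (markedCount X / (s : ℝ) ^ d) * (1 - markedCount X / (s : ℝ) ^ d) ≤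
          (Finset.univ.filter fun ω => ∃ z, ∀ y, itemMarked pt act X ω y = true ↔ y = z).card /
            Fintype.card Ω := by
  classical
  have hcell : ∀ v : Fin ℓ, (v : ℕ) / s < b ^ R := fun v =>
    Nat.div_lt_of_lt_mul (v.2.trans_le hR)
  let cell : (Fin d → Fin ℓ) → Fin R → Fin d → Fin b := fun v i j =>
    finFunctionFinEquiv.symm ⟨v j / s, hcell (v j)⟩ i
  let off : (Fin d → Fin ℓ) → Fin d → Fin s := fun v j => ⟨v j % s, Nat.mod_lt _ hs⟩
  let val : (Fin R → Fin d → Fin b) → Fin d → ℕ := fun y j => ∑ i, (y i j : ℕ) * b ^ (i : ℕ)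
  have hval : ∀ v j, val (cell v) j = v j / s := fun v j => by
    have := congrArg Fin.val
      (finFunctionFinEquiv.apply_symm_apply (⟨v j / s, hcell (v j)⟩ : Fin (b ^ R)))
    rwa [finFunctionFinEquiv_apply_val] at this
  have hinj : ∀ v v', cell v = cell v' → off v = off v' → v = v' := fun v v' h h' => by
    funext j
    have h1 : (v j : ℕ) / s = v' j / s := by rw [← hval, ← hval, h]
    have h2 : (v j : ℕ) % s = v' j % s := congrArg Fin.val (congrFun h' j)
    exact Fin.ext (by rw [← Nat.div_add_mod (v j) s, ← Nat.div_add_mod (v' j) s, h1, h2])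
  -- The outermost cube may overshoot the grid, so corners are clamped to it; clamping does not
  -- increase distances.
  let loc : (Fin R → Fin d → Fin b) → Fin d → Fin ℓ := fun y j =>
    ⟨min (s * val y j) (ℓ - 1), by omega⟩
  -- The chosen offset may fall outside the grid. The cell is then inactive and its corner is a
  -- dummy point.
  let pt : ((Fin R → Fin d → Fin b) → Fin d → Fin s) → (Fin R → Fin d → Fin b) → Fin d → Fin ℓ :=
    fun ω y => if h : ∃ v, cell v = y ∧ off v = ω y then h.choose else loc y
  let act : ((Fin R → Fin d → Fin b) → Fin d → Fin s) → (Fin R → Fin d → Fin b) → Bool :=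
    fun ω y => decide (∃ v, cell v = y ∧ off v = ω y)
  have : Nonempty (Fin s) := ⟨⟨0, hs⟩⟩
  refine ⟨(Fin R → Fin d → Fin b) → Fin d → Fin s, inferInstance, inferInstance, loc, pt, act,
    fun ω y => gridGraph_exists_walk _ _ _ fun j => ?_,
    fun r y => gridGraph_exists_walk _ _ _ fun j => ?_,
    fun v y => gridGraph_exists_walk _ _ _ fun j => ?_, fun X => ?_⟩
  · by_cases h : ∃ v, cell v = y ∧ off v = ω y
    · have h1 : pt ω y = h.choose := dif_pos h
      have h2 : val y j = h.choose j / s := by rw [← hval, h.choose_spec.1]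
      have h3 := Nat.div_add_mod (h.choose j) s
      have h4 := Nat.mod_lt (h.choose j) hs
      have h5 := (h.choose j).2
      simp only [h1, loc, h2]
      omega
    · have h1 : pt ω y = loc y := dif_neg h
      rw [h1]
      omega
  · have h1 : val (Function.update y r 0) j ≤ val y j := by
      refine Finset.sum_le_sum fun i _ => ?_
      by_cases hi : i = r
      · subst hi; simp
      · simp [hi]
    have h2 : val y j ≤ val (Function.update y r 0) j + b ^ (r.val + 1) := by
      have : b ^ (r.val + 1) = ∑ i : Fin R, if i = r then b ^ (r.val + 1) else 0 := by simp
      rw [this, ← Finset.sum_add_distrib]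
      refine Finset.sum_le_sum fun i _ => ?_
      by_cases hi : i = r
      · subst hi
        rw [if_pos rfl, pow_succ']
        exact (Nat.mul_le_mul_right _ (y i j).2.le).trans (Nat.le_add_left _ _)
      · simp [hi]
    have h3 := Nat.mul_le_mul_left s h1
    have h4 := Nat.mul_le_mul_left s h2
    rw [Nat.mul_add] at h4
    simp only [loc]
    omega
  · have h1 := (v j).2
    have h2 := (loc y j).2
    omega
  · have hmark : ∀ ω y, itemMarked pt act X ω y = true ↔
        ∃ v, X v = true ∧ ω (cell v) = off v ∧ cell v = y := by
      intro ω y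
      simp only [itemMarked, Bool.and_eq_true, act, decide_eq_true_eq]
      constructor
      · rintro ⟨h, hX⟩
        have h1 : pt ω y = h.choose := dif_pos h
        rw [h1] at hX
        exact ⟨h.choose, hX, by rw [h.choose_spec.1, h.choose_spec.2], h.choose_spec.1⟩
      · rintro ⟨v, hX, h1, rfl⟩
        have h : ∃ v', cell v' = cell v ∧ off v' = ω (cell v) := ⟨v, rfl, h1.symm⟩
        refine ⟨h, ?_⟩
        have h2 : pt ω (cell v) = h.choose := dif_pos h
        rwa [h2, hinj h.choose v h.choose_spec.1 (by rw [h.choose_spec.2, h1])]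
    have key := le_card_filter_card_eq_one cell off hinj (Finset.univ.filter fun v => X v = true)
    have hO : (Fintype.card (Fin d → Fin s) : ℝ) = (s : ℝ) ^ d := by simp
    rw [hO] at key
    refine key.trans ?_
    gcongr with ω
    intro hω
    obtain ⟨v, hv⟩ := Finset.card_eq_one.1 hω
    have hv' : ∀ v', (X v' = true ∧ ω (cell v') = off v') ↔ v' = v := fun v' => by
      rw [← Finset.mem_singleton (a := v), ← hv]; simp
    refine ⟨cell v, fun y => ?_⟩
    rw [hmark]
    constructor
    · rintro ⟨v', h1, h2, rfl⟩
      rw [(hv' v').1 ⟨h1, h2⟩]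
    · rintro rfl
      exact ⟨v, ((hv' v).2 rfl).1, ((hv' v).2 rfl).2, rfl⟩

end Grid

/-! ### Growth of amplitudes. -/

section AmplitudeBounds

/-- The bounds mimic x - x³/6 ≤ sin x ≤ x. The coefficient 1/6 reproduces itself under tripling: 3/6
+ 4 = 27/6. -/
theorem sinTriple_iterate_mem {a : ℝ} (ha : 0 ≤ a) (t : ℕ) (h : 3 ^ t * a ≤ 1 / 2) :
    3 ^ t * a - (3 ^ t * a) ^ 3 / 6 ≤ sinTriple^[t] a ∧ sinTriple^[t] a ≤ 3 ^ t * a := by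
  induction t with
  | zero => simp; positivity
  | succ t ih =>
    rw [pow_succ', mul_assoc] at h ⊢
    set x := 3 ^ t * a with hx
    have hx0 : 0 ≤ x := by positivity
    obtain ⟨h1, h2⟩ := ih (by linarith)
    rw [Function.iterate_succ_apply', sinTriple]
    set y := sinTriple^[t] a
    have hy0 : 0 ≤ y := by nlinarith [mul_nonneg hx0 hx0, mul_nonneg (mul_nonneg hx0 hx0) hx0]
    have h3 : y ^ 3 ≤ x ^ 3 := pow_le_pow_left₀ hy0 h2 3
    have h4 : 0 ≤ y ^ 3 := by positivity
    have h5 : 0 ≤ x ^ 3 := by positivity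
    constructor <;> nlinarith

/-- An amplitude `a` can be made constant with `O(1 / a)` repetitions. -/
theorem exists_sinTriple_iterate_ge {a : ℝ} (ha : 0 < a) (ha1 : a ≤ 1) :
    ∃ t : ℕ, (3 : ℝ) ^ t ≤ 1 / a ∧ 1 / 7 ≤ sinTriple^[t] a := by
  by_cases h : 1 / 6 < a
  · exact ⟨0, by rw [pow_zero, le_div_iff₀ ha]; linarith, by simp; linarith⟩
  · push Not at h
    -- The factor 6 puts x = 3^(t+1) a above 1/6 and at most at 1/2, where x - x³/6 ≥ 23x/24 > 1/7.
    obtain ⟨t, h1, h2⟩ := exists_nat_pow_near (x := 1 / (6 * a)) (y := (3 : ℝ))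
      (by rw [le_div_iff₀ (by positivity)]; linarith) (by norm_num)
    rw [le_div_iff₀ (by positivity)] at h1
    rw [div_lt_iff₀ (by positivity)] at h2
    have h3 : (3 : ℝ) ^ (t + 1) * a ≤ 1 / 2 := by rw [pow_succ]; linarith
    refine ⟨t + 1, ?_, ?_⟩
    · rw [le_div_iff₀ ha]; linarith
    · refine le_trans ?_ (sinTriple_iterate_mem ha.le (t + 1) h3).1
      set x := (3 : ℝ) ^ (t + 1) * a with hx
      have h4 : 1 / 6 < x := by linarith
      have h5 : x ^ 2 ≤ (1 / 2) ^ 2 := pow_le_pow_left₀ (by linarith) h3 2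
      have h6 : x * x ^ 2 ≤ x * (1 / 2) ^ 2 := mul_le_mul_of_nonneg_left h5 (by linarith)
      have h7 : x ^ 3 = x * x ^ 2 := by ring
      rw [h7]
      linarith

/-- Division by three and tripling cancel, leaving only the cubic loss a ↦ a(1 - 4a²/27). So 1/a²
grows by at most 1 per level. -/
theorem sinTriple_div_three {a : ℝ} {r : ℕ} (ha : 0 < a) (ha1 : a ≤ 1)
    (h : 1 ≤ a ^ 2 * (r + 1)) :
    0 < sinTriple (a / 3) ∧ sinTriple (a / 3) ≤ 1 ∧
      1 ≤ sinTriple (a / 3) ^ 2 * ((r + 1 : ℕ) + 1) := by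
  have e : sinTriple (a / 3) = a * (1 - 4 / 27 * a ^ 2) := by rw [sinTriple]; ring
  have h2 : a ^ 2 ≤ 1 := pow_le_one₀ ha.le ha1
  have h3 : 0 < a ^ 2 := by positivity
  rw [e]
  refine ⟨mul_pos ha (by linarith), ?_, ?_⟩
  · exact mul_le_one₀ ha1 (by linarith) (by linarith)
  · push_cast
    set z := a ^ 2 with hz
    have e2 : (a * (1 - 4 / 27 * z)) ^ 2 * (r + 1 + 1) =
        (1 - 4 / 27 * z) ^ 2 * (z * (r + 1) + z) := by rw [hz]; ring
    rw [e2]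
    calc (1 : ℝ) ≤ (1 - 4 / 27 * z) ^ 2 * (1 + z) := by nlinarith [mul_pos h3 h3]
      _ ≤ _ := by gcongr

/-- Here `z` is the lossless amplitude, and the factor (1 + z)/2 pays for the losses. Passing from z
to qz frees a relative slack of order z, while the cubic loss is of relative order z². As the factor
stays above 1/2, half of the lossless amplitude survives all levels. -/
theorem sinTriple_two_div {a q Q z : ℝ} (hQ : 0 < Q) (hq : q = 9 / Q) (hq2 : q ^ 2 ≤ 81 / 512)
    (hz : 0 < z) (hz1 : z ≤ 1) (hl : z * (1 + z) / 2 ≤ a) (hu : a ≤ z) :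
    q * z * (1 + q * z) / 2 ≤ sinTriple^[2] (a / Q) ∧ sinTriple^[2] (a / Q) ≤ q * z := by
  have hq0 : 0 < q := by rw [hq]; positivity
  have hq1 : q ≤ 2 / 5 := by
    by_contra! h
    nlinarith
  have ha : 0 < a := by nlinarith
  have e : (3 : ℝ) ^ 2 * (a / Q) = q * a := by rw [hq]; ring
  have h1 : q * a ≤ 1 / 2 := by nlinarith
  obtain ⟨h2, h3⟩ := sinTriple_iterate_mem (a := a / Q) (by positivity) 2 (by rw [e]; exact h1)
  rw [e] at h2 h3
  refine ⟨le_trans ?_ h2, h3.trans (by gcongr)⟩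
  have h4 : (q * a) ^ 2 ≤ 81 / 512 * z ^ 2 := by
    rw [mul_pow]
    gcongr
  have h5 : z * (1 + z) / 2 * (1 - 81 / 3072 * z ^ 2) ≥ z * (1 + q * z) / 2 := by
    have h6 : z ^ 2 ≤ z := by nlinarith
    have h7 : (1 + z) * (1 - 81 / 3072 * z ^ 2) ≥ 1 + q * z := by
      nlinarith [mul_nonneg hz.le (sub_nonneg.2 h6), mul_le_mul_of_nonneg_right hq1 hz.le]
    nlinarith
  have h8 : 0 ≤ 1 - 81 / 3072 * z ^ 2 := by nlinarith
  calc q * z * (1 + q * z) / 2 = q * (z * (1 + q * z) / 2) := by ring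
    _ ≤ q * (z * (1 + z) / 2 * (1 - 81 / 3072 * z ^ 2)) := by gcongr
    _ ≤ q * (a * (1 - 81 / 3072 * z ^ 2)) := by gcongr
    _ = q * a * (1 - 81 / 512 * z ^ 2 / 6) := by ring
    _ ≤ q * a * (1 - (q * a) ^ 2 / 6) := by gcongr
    _ = _ := by ring

end AmplitudeBounds

/-! ### Cost and amplitude over all levels. -/

section Levels

variable {V : Type*} {G : SimpleGraph V} {Ω : Type} {R : ℕ} {D : Type} [Fintype D] [DecidableEq D]
  [Zero D] {loc : (Fin R → D) → V} {pt : Ω → (Fin R → D) → V} {act : Ω → (Fin R → D) → Bool}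
  {m b : ℕ}

theorem HasSearch.level {r T : ℕ} {α : ℝ} (h : HasSearch G loc pt act r T α) (hr : r < R)
    (hm0 : 0 < m) (hb : 0 < b) (hm : ∀ ω y, ∃ p : G.Walk (loc y) (pt ω y), p.length ≤ m)
    (hw : ∀ (r : Fin R) y, ∃ p : G.Walk (loc y) (loc (Function.update y r 0)),
      p.length ≤ m * b ^ (r.val + 1)) (t : ℕ) :
    ∃ T' ≤ 3 ^ t * (T + 10 * (m * b ^ (r + 1))),
      HasSearch G loc pt act (r + 1) T' (sinTriple^[t] (α / Real.sqrt (Fintype.card D))) := by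
  obtain ⟨T', h1, h2⟩ := (HasSearch.succ (r := ⟨r, hr⟩) h (hw ⟨r, hr⟩)).amplify_iterate hm t
  refine ⟨T', h1.trans (Nat.mul_le_mul_left _ ?_), h2⟩
  -- With X = m b^(r+1) ≥ 1 the overhead is 4X + 2 from spreading the digit and 2m + 2 from
  -- amplification, at most 10X.
  have h3 : m * 1 ≤ m * b ^ (r + 1) := Nat.mul_le_mul_left _ (Nat.one_le_pow _ _ hb)
  simp only
  omega

/-- Search cost and walk length both triple per level, so all levels contribute alike; hence the
factor `r`. -/
theorem HasSearch.levels_of_card_eq_nine (hD : Fintype.card D = 9) (hm0 : 0 < m)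
    (hm : ∀ ω y, ∃ p : G.Walk (loc y) (pt ω y), p.length ≤ m)
    (hw : ∀ (r : Fin R) y, ∃ p : G.Walk (loc y) (loc (Function.update y r 0)),
      p.length ≤ m * 3 ^ (r.val + 1)) (r : ℕ) (hr : r ≤ R) :
    ∃ (T : ℕ) (α : ℝ), T ≤ 30 * m * r * 3 ^ r ∧ 0 < α ∧ α ≤ 1 ∧ 1 ≤ α ^ 2 * (r + 1) ∧
      HasSearch G loc pt act r T α := by
  induction r with
  | zero => exact ⟨0, 1, by simp, by simp, by simp, by simp, HasSearch.zero⟩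
  | succ r ih =>
    obtain ⟨T, α, hT, h0, h1, h2, hs⟩ := ih (by omega)
    obtain ⟨T', hT', hs'⟩ := hs.level (by omega) hm0 (by norm_num : 0 < 3) hm hw 1
    have hsq : Real.sqrt (Fintype.card D) = 3 := by
      rw [hD, Real.sqrt_eq_iff_mul_self_eq (by norm_num) (by norm_num)]; norm_num
    rw [hsq, Function.iterate_one] at hs'
    obtain ⟨h3, h4, h5⟩ := sinTriple_div_three h0 h1 h2
    refine ⟨T', _, ?_, h3, h4, h5, hs'⟩
    refine hT'.trans ((Nat.mul_le_mul_left _ (Nat.add_le_add_right hT _)).trans (le_of_eq ?_))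
    ring

/-- The choice rests on 8 < 9 < 8^(3/2): walks grow more slowly than the search cost, and two rounds
do not overshoot the amplitude. The bound 720 m (9^r - 8^r) solves T' = 9 (T + 80 m 8^r) exactly. -/
theorem HasSearch.levels_of_card_eq_eight_pow {d : ℕ} (hd : 3 ≤ d) (hD : Fintype.card D = 8 ^ d)
    (hm0 : 0 < m) (hm : ∀ ω y, ∃ p : G.Walk (loc y) (pt ω y), p.length ≤ m)
    (hw : ∀ (r : Fin R) y, ∃ p : G.Walk (loc y) (loc (Function.update y r 0)),
      p.length ≤ m * 8 ^ (r.val + 1)) (r : ℕ) (hr : r ≤ R) :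
    ∃ T α, T + 720 * m * 8 ^ r ≤ 720 * m * 9 ^ r ∧
      (9 / Real.sqrt (8 ^ d)) ^ r * (1 + (9 / Real.sqrt (8 ^ d)) ^ r) / 2 ≤ α ∧
      α ≤ (9 / Real.sqrt (8 ^ d)) ^ r ∧ HasSearch G loc pt act r T α := by
  have hQ : 0 < Real.sqrt (8 ^ d) := Real.sqrt_pos.2 (by positivity)
  have hq2 : (9 / Real.sqrt (8 ^ d)) ^ 2 ≤ 81 / 512 := by
    rw [div_pow, Real.sq_sqrt (by positivity)]
    have : (8 : ℝ) ^ 3 ≤ 8 ^ d := pow_le_pow_right₀ (by norm_num) hd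
    rw [show (81 : ℝ) / 512 = 9 ^ 2 / 8 ^ 3 by norm_num]
    gcongr
  have hq1 : 9 / Real.sqrt (8 ^ d) ≤ 1 := by
    by_contra! h
    nlinarith
  induction r with
  | zero => exact ⟨0, 1, by simp, by norm_num, by simp, HasSearch.zero⟩
  | succ r ih =>
    obtain ⟨T, α, hT, h1, h2, hs⟩ := ih (by omega)
    obtain ⟨T', hT', hs'⟩ := hs.level (by omega) hm0 (by norm_num : 0 < 8) hm hw 2
    have hsq : Real.sqrt (Fintype.card D) = Real.sqrt (8 ^ d) := by rw [hD]; push_cast; rfl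
    rw [hsq] at hs'
    obtain ⟨h3, h4⟩ := sinTriple_two_div hQ rfl hq2 (z := (9 / Real.sqrt (8 ^ d)) ^ r)
      (by positivity) (pow_le_one₀ (by positivity) hq1) h1 h2
    refine ⟨T', _, ?_, by rw [pow_succ']; exact h3, by rw [pow_succ']; exact h4, hs'⟩
    rw [pow_succ 8 r, pow_succ 9 r]
    rw [pow_succ 8 r] at hT'
    have e1 : 720 * m * (8 ^ r * 8) = 8 * (720 * m * 8 ^ r) := by ring
    have e2 : 720 * m * (9 ^ r * 9) = 9 * (720 * m * 9 ^ r) := by ring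
    have e3 : 3 ^ 2 * (T + 10 * (m * (8 ^ r * 8))) = 9 * T + 720 * m * 8 ^ r := by ring
    omega

end Levels

/-! ### Search for a guessed number of marked vertices, and dimension at least three. -/

section Guess

/-- A procedure that looks for the marked vertices of a grid, given their number up to a factor
of two. -/
def GuessProcedure (d ℓ κ : ℕ) (v₁ : Fin d → Fin ℓ) (B : ℝ) : Prop :=
  ∃ T g, FlagProcedure (gridGraph d ℓ) v₁ T g ∧ g (fun _ => false) = 1 ∧
    (∀ X, κ ≤ markedCount X → markedCount X < 2 * κ → g X ≤ 1 - 1 / (49 * 2 ^ (d + 3))) ∧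
    (T : ℝ) ≤ B

theorem GuessProcedure.mono {d ℓ κ : ℕ} {v₁ : Fin d → Fin ℓ} {B B' : ℝ}
    (h : GuessProcedure d ℓ κ v₁ B) (hB : B ≤ B') : GuessProcedure d ℓ κ v₁ B' :=
  let ⟨T, g, h1, h2, h3, h4⟩ := h
  ⟨T, g, h1, h2, h3, h4.trans hB⟩

/-- Order 1/α₀ repetitions raise the amplitude to 1/7. The bounds on s^d put the expected number μ
of active marked points between 1/(4·2^d) and 1/2, so a unique one exists with probability at least
1/2^(d+3). The product with (1/7)² is the success probability. -/
theorem guessProcedure_of_levels {d ℓ b s R κ : ℕ} [NeZero b] {B α₀ : ℝ} (hd : 0 < d) (hℓ : 0 < ℓ)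
    (hs : 0 < s) (hR : ℓ ≤ s * b ^ R) (h4 : 4 * κ ≤ s ^ d)
    (h4' : s ^ d ≤ 2 ^ d * (4 * κ)) (hα₀ : 0 < α₀)
    (hlev : ∀ (Ω : Type) (loc : (Fin R → Fin d → Fin b) → Fin d → Fin ℓ)
      (pt : Ω → (Fin R → Fin d → Fin b) → Fin d → Fin ℓ) (act : Ω → (Fin R → Fin d → Fin b) → Bool),
      (∀ ω y, ∃ p : (gridGraph d ℓ).Walk (loc y) (pt ω y), p.length ≤ d * s) →
      (∀ (r : Fin R) y, ∃ p : (gridGraph d ℓ).Walk (loc y) (loc (Function.update y r 0)),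
        p.length ≤ d * s * b ^ (r.val + 1)) →
      ∃ (T : ℕ) (α : ℝ), (T : ℝ) ≤ B ∧ α₀ ≤ α ∧ α ≤ 1 ∧
        HasSearch (gridGraph d ℓ) loc pt act R T α) (v₁ : Fin d → Fin ℓ) :
    GuessProcedure d ℓ κ v₁ ((B + 4 * d * s) / α₀ + 4 * d * s + 4 * d * ℓ + 4) := by
  obtain ⟨Ω, _, _, loc, pt, act, hm, hw, hM, hcount⟩ := exists_grid_hierarchy d hℓ hs hR
  obtain ⟨T, α, hT, hα, hα1, hsearch⟩ := hlev Ω loc pt act hm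
    fun r y => by simpa only [mul_assoc] using hw r y
  have hαpos := hα₀.trans_le hα
  obtain ⟨t, ht, hα7⟩ := exists_sinTriple_iterate_ge hαpos hα1
  obtain ⟨T', hT', hsearch'⟩ := hsearch.amplify_iterate hm t
  obtain ⟨g, hg, hg0, hgX⟩ := hsearch'.flagProcedure hm v₁ (hM v₁)
  refine ⟨_, g, hg, hg0, fun X hX hX' => (hgX X).trans ?_, ?_⟩
  · set c := sinTriple^[t] α
    have hc : (1 / 7 : ℝ) ^ 2 ≤ c ^ 2 := pow_le_pow_left₀ (by norm_num) hα7 2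
    set S : ℝ := (s : ℝ) ^ d with hS
    have hSpos : 0 < S := by positivity
    have k1 : (4 * κ : ℝ) ≤ S := by rw [hS]; exact_mod_cast h4
    have k2 : S ≤ 2 ^ d * (4 * κ) := by rw [hS]; exact_mod_cast h4'
    have k3 : (κ : ℝ) ≤ markedCount X := by exact_mod_cast hX
    have k4 : (markedCount X : ℝ) ≤ 2 * κ := by exact_mod_cast hX'.le
    set μ : ℝ := markedCount X / S with hμ
    have m1 : 1 / (4 * 2 ^ d) ≤ μ := by
      rw [hμ, div_le_div_iff₀ (by positivity) hSpos]
      nlinarith [mul_le_mul_of_nonneg_right k3 (by positivity : (0 : ℝ) ≤ 4 * 2 ^ d)]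
    have m2 : μ ≤ 1 / 2 := by
      rw [hμ, div_le_div_iff₀ hSpos (by norm_num)]
      linarith
    have m3 : 1 / 2 ^ (d + 3) ≤ μ * (1 - μ) := by
      have e : (1 : ℝ) / 2 ^ (d + 3) = 1 / (4 * 2 ^ d) * (1 / 2) := by
        rw [pow_add]; field_simp; norm_num
      rw [e]
      exact mul_le_mul m1 (by linarith) (by norm_num) (le_trans (by positivity) m1)
    have m4 := m3.trans (hcount X)
    have m5 := mul_le_mul hc m4 (by positivity) (by positivity)
    have e : (1 / 7 : ℝ) ^ 2 * (1 / 2 ^ (d + 3)) = 1 / (49 * 2 ^ (d + 3)) := by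
      field_simp; norm_num
    rw [e] at m5
    linarith
  · have hds : (1 : ℝ) ≤ d * s := by exact_mod_cast Nat.mul_pos hd hs
    have k1 : (T' : ℝ) ≤ 3 ^ t * (T + (2 * (d * s) + 2)) := by exact_mod_cast hT'
    have k2 : (3 : ℝ) ^ t * (T + (2 * (d * s) + 2)) ≤ 1 / α₀ * (B + 4 * d * s) := by
      refine mul_le_mul (ht.trans ?_) (by linarith) (by positivity) (by positivity)
      exact one_div_le_one_div_of_le hα₀ hα
    push_cast
    rw [div_eq_mul_one_div, mul_comm (B + 4 * d * s)]
    linarith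

theorem exists_cell_side {d κ : ℕ} (hd : 0 < d) (hκ : 0 < κ) :
    ∃ s, 0 < s ∧ 4 * κ ≤ s ^ d ∧ s ^ d ≤ 2 ^ d * (4 * κ) := by
  have hex : ∃ s, 4 * κ ≤ s ^ d := ⟨4 * κ, Nat.le_self_pow hd.ne' _⟩
  classical
  have h1 := Nat.find_spec hex
  -- The least side s is at least 2, so s ≤ 2(s - 1), and minimality costs only the factor 2^d.
  have h0 : Nat.find hex ≠ 0 := fun h => by
    rw [h, zero_pow hd.ne'] at h1; omega
  have h2 : Nat.find hex ≠ 1 := fun h => by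
    rw [h, one_pow] at h1; omega
  have h3 := Nat.find_min hex (m := Nat.find hex - 1) (by omega)
  refine ⟨Nat.find hex, by omega, h1, ?_⟩
  calc Nat.find hex ^ d ≤ (2 * (Nat.find hex - 1)) ^ d := Nat.pow_le_pow_left (by omega) d
    _ = 2 ^ d * (Nat.find hex - 1) ^ d := Nat.mul_pow _ _ _
    _ ≤ _ := Nat.mul_le_mul_left _ (by omega)

theorem exists_level_count {b ℓ s : ℕ} (hb : 2 ≤ b) (hs : 0 < s) :
    ∃ R, ℓ ≤ s * b ^ R ∧ (R = 0 ∨ s * b ^ R ≤ b * ℓ) := by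
  have hex : ∃ R, ℓ ≤ s * b ^ R := ⟨ℓ, (Nat.lt_pow_self hb).le.trans (Nat.le_mul_of_pos_left _ hs)⟩
  classical
  refine ⟨Nat.find hex, Nat.find_spec hex, ?_⟩
  by_cases h : Nat.find hex = 0
  · exact Or.inl h
  · right
    have h3 := Nat.find_min hex (m := Nat.find hex - 1) (by omega)
    obtain ⟨R, hR⟩ := Nat.exists_eq_succ_of_ne_zero h
    rw [hR] at h3 ⊢
    simp only [Nat.succ_eq_add_one, Nat.add_sub_cancel, not_le] at h3
    rw [Nat.succ_eq_add_one, pow_succ]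
    calc s * (b ^ R * b) = b * (s * b ^ R) := by ring
      _ ≤ b * ℓ := Nat.mul_le_mul_left _ h3.le

theorem cell_side_le {d κ s : ℕ} {x : ℝ} (hd : 0 < d) (hx : 0 ≤ x) (hxκ : x ^ d = κ)
    (h4' : s ^ d ≤ 2 ^ d * (4 * κ)) : (s : ℝ) ≤ 8 * x := by
  refine (pow_le_pow_iff_left₀ (by positivity) (by positivity) hd.ne').1 ?_
  calc (s : ℝ) ^ d ≤ 2 ^ d * (4 * κ) := by exact_mod_cast h4'
    _ ≤ 2 ^ d * (4 ^ d * κ) := by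
        gcongr
        exact le_self_pow₀ (by norm_num) hd.ne'
    _ = (8 * x) ^ d := by rw [mul_pow, hxκ, ← mul_assoc, ← mul_pow]; norm_num

/-- With x = κ^(1/d) and y = ℓ/x the target is x y^(d/2). The side s lies between x and 8x, and 8^R
≤ 8y, so cost over amplitude, of order s Q^R, is as required. -/
theorem exists_guessProcedure_of_three_le {d : ℕ} (hd : 3 ≤ d) :
    ∃ C : ℝ, 0 < C ∧ ∀ (ℓ κ : ℕ) (v₁ : Fin d → Fin ℓ), 1 ≤ κ → κ ≤ ℓ ^ d →
      GuessProcedure d ℓ κ v₁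
        (C * (Real.sqrt ((ℓ ^ d : ℕ) : ℝ) / (κ : ℝ) ^ ((1 / 2 : ℝ) - 1 / (d : ℝ)))) := by
  set Q := Real.sqrt (8 ^ d) with hQdef
  have hQ : 0 < Q := Real.sqrt_pos.2 (by positivity)
  -- 11584 = 1448 · 8 comes from the levels, 36 = 32 + 4 from walks in a cell and from `v₁`.
  refine ⟨11584 * d * Q + 36 * d + 4, by positivity, fun ℓ κ v₁ hκ hκn => ?_⟩
  have hd0 : 0 < d := by omega
  have hℓ : 0 < ℓ := Nat.pos_of_ne_zero fun h => by
    rw [h, zero_pow hd0.ne'] at hκn; omega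
  obtain ⟨s, hs, h4, h4'⟩ := exists_cell_side hd0 hκ
  obtain ⟨R, hR, hR'⟩ := exists_level_count (b := 8) (ℓ := ℓ) (by norm_num) hs
  have hκ0 : (0 : ℝ) < κ := by exact_mod_cast hκ
  set x : ℝ := (κ : ℝ) ^ (1 / (d : ℝ)) with hx
  have hx1 : 1 ≤ x := Real.one_le_rpow (by exact_mod_cast hκ) (by positivity)
  have hxκ : x ^ d = κ := by
    rw [hx, one_div, Real.rpow_inv_natCast_pow hκ0.le hd0.ne']
  have hs8 : (s : ℝ) ≤ 8 * x := cell_side_le hd0 (by positivity) hxκ h4'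
  have hxs : x ≤ s := by
    refine (pow_le_pow_iff_left₀ (by positivity) (by positivity) hd0.ne').1 ?_
    rw [hxκ]
    have : (4 * κ : ℝ) ≤ (s : ℝ) ^ d := by exact_mod_cast h4
    linarith
  have hxℓ : x ≤ ℓ := by
    refine (pow_le_pow_iff_left₀ (by positivity) (by positivity) hd0.ne').1 ?_
    rw [hxκ]
    exact_mod_cast hκn
  set y : ℝ := ℓ / x with hy
  have hxy : x * y = ℓ := by rw [hy]; field_simp
  have hy1 : 1 ≤ y := by rw [hy, le_div_iff₀ (by positivity)]; linarith
  set Z : ℝ := Real.sqrt (y ^ d) with hZ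
  have hyZ : y ≤ Z := by
    rw [hZ]
    refine Real.le_sqrt_of_sq_le (pow_le_pow_right₀ hy1 (by omega))
  have hZ1 : 1 ≤ Z := hy1.trans hyZ
  have hbound : Real.sqrt ((ℓ ^ d : ℕ) : ℝ) / (κ : ℝ) ^ ((1 / 2 : ℝ) - 1 / (d : ℝ)) = x * Z := by
    rw [Real.rpow_sub hκ0, ← hx, ← Real.sqrt_eq_rpow]
    have : (κ : ℝ) * y ^ d = ((ℓ ^ d : ℕ) : ℝ) := by
      rw [← hxκ, ← mul_pow, hxy]; push_cast; rfl
    rw [← this, Real.sqrt_mul hκ0.le]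
    have : 0 < Real.sqrt κ := Real.sqrt_pos.2 hκ0
    rw [← hZ]
    field_simp
  rw [hbound]
  have h8R : (8 : ℝ) ^ R ≤ 8 * y := by
    rcases hR' with rfl | h
    · simp; linarith
    · have h' : (s : ℝ) * 8 ^ R ≤ 8 * ℓ := by exact_mod_cast h
      rw [← hxy] at h'
      have : x * 8 ^ R ≤ x * (8 * y) := by
        calc x * 8 ^ R ≤ s * 8 ^ R := by gcongr
          _ ≤ _ := by linarith
      exact le_of_mul_le_mul_left this (by positivity)
  have hQR : Q ^ R ≤ Q * Z := by
    rw [hQdef, hZ, ← Real.sqrt_mul (by positivity), ← mul_pow]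
    refine Real.le_sqrt_of_sq_le ?_
    rw [← pow_mul, mul_comm R 2, pow_mul, Real.sq_sqrt (by positivity), ← pow_mul, mul_comm d R,
      pow_mul]
    gcongr
  have h := guessProcedure_of_levels (b := 8) (R := R) (B := 720 * (d * s) * 9 ^ R)
    (α₀ := (9 / Q) ^ R / 2) hd0 hℓ hs hR h4 h4' (by positivity)
    (fun Ω loc pt act hm hw => by
      obtain ⟨T, α, hT, h1, h2, h3⟩ := HasSearch.levels_of_card_eq_eight_pow hd (by simp)
        (Nat.mul_pos hd0 hs) hm hw R le_rfl
      refine ⟨T, α, ?_, ?_, ?_, h3⟩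
      · exact_mod_cast (Nat.le_add_right _ _).trans hT
      · refine le_trans ?_ h1
        rw [← hQdef]
        have : 0 < (9 / Q) ^ R := by positivity
        nlinarith
      · refine h2.trans (pow_le_one₀ (by positivity) ?_)
        rw [div_le_one hQ]
        refine Real.le_sqrt_of_sq_le ?_
        calc (9 : ℝ) ^ 2 ≤ 8 ^ 3 := by norm_num
          _ ≤ 8 ^ d := pow_le_pow_right₀ (by norm_num) hd) v₁
  refine h.mono ?_
  have hxZ : x ≤ x * Z := le_mul_of_one_le_right (by positivity) hZ1
  have hmain : (720 * (d * s) * 9 ^ R + 4 * d * s) / ((9 / Q) ^ R / 2) ≤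
      11584 * d * Q * (x * Z) := by
    have e : (720 * (d * s) * 9 ^ R + 4 * d * s) / ((9 / Q) ^ R / 2) =
        1440 * (d * s) * Q ^ R + 8 * (d * s) * Q ^ R / 9 ^ R := by
      rw [div_pow]; field_simp; ring
    have h9 : 8 * (d * s) * Q ^ R / 9 ^ R ≤ 8 * (d * s) * Q ^ R :=
      div_le_self (by positivity) (one_le_pow₀ (by norm_num))
    rw [e]
    calc _ ≤ 1448 * (d * s) * Q ^ R := by linarith
      _ ≤ 1448 * (d * (8 * x)) * (Q * Z) := by gcongr
      _ = _ := by ring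
  have h1 : (4 * d * s : ℝ) ≤ 32 * d * (x * Z) := by
    calc (4 * d * s : ℝ) ≤ 4 * d * (8 * x) := by gcongr
      _ ≤ 4 * d * (8 * (x * Z)) := by gcongr
      _ = _ := by ring
  have h2 : (4 * d * ℓ : ℝ) ≤ 4 * d * (x * Z) := by
    rw [← hxy]; gcongr
  have h3 : 1 ≤ x * Z := hx1.trans hxZ
  linarith

end Guess

/-! ### Dimension two. -/

theorem rpow_three_halves {L : ℝ} (hL : 0 < L) : L ^ (3 / 2 : ℝ) = L * Real.sqrt L := by
  rw [Real.sqrt_eq_rpow, show (3 / 2 : ℝ) = 1 + 1 / 2 by norm_num, Real.rpow_add hL, Real.rpow_one]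

theorem one_le_log_sq {ℓ : ℕ} (hℓ : 2 ≤ ℓ) : 1 ≤ Real.log ((ℓ ^ 2 : ℕ) : ℝ) := by
  have h : (2 : ℝ) ≤ ℓ := by exact_mod_cast hℓ
  have h2 := Real.log_le_log (by norm_num) h
  have h3 := Real.log_two_gt_d9
  push_cast
  rw [Real.log_pow]
  push_cast
  linarith

/-- Since s 3^R = O(ℓ) and R = O(log n), the levels cost O(ℓ R), and the amplitude 1/√(R+1) adds a
factor √(R+1). -/
theorem exists_guessProcedure_two :
    ∃ C : ℝ, 0 < C ∧ ∀ (ℓ κ : ℕ) (v₁ : Fin 2 → Fin ℓ), 2 ≤ ℓ → 1 ≤ κ → κ ≤ ℓ ^ 2 →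
      GuessProcedure 2 ℓ κ v₁
        (C * (Real.sqrt ((ℓ ^ 2 : ℕ) : ℝ) * Real.log ((ℓ ^ 2 : ℕ) : ℝ) ^ (3 / 2 : ℝ))) := by
  -- 3840 for the levels, 64 for walks in a cell, 8 for walks from `v₁`, and 4.
  refine ⟨3916, by norm_num, fun ℓ κ v₁ hℓ2 hκ hκn => ?_⟩
  have hℓ : 0 < ℓ := by omega
  obtain ⟨s, hs, h4, h4'⟩ := exists_cell_side (d := 2) (by norm_num) hκ
  obtain ⟨R, hR, hR'⟩ := exists_level_count (b := 3) (ℓ := ℓ) (by norm_num) hs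
  have hL1 := one_le_log_sq hℓ2
  have hsqrt : Real.sqrt ((ℓ ^ 2 : ℕ) : ℝ) = ℓ := by push_cast; exact Real.sqrt_sq (by positivity)
  rw [hsqrt, rpow_three_halves (by linarith)]
  have hLℓ : Real.log ((ℓ ^ 2 : ℕ) : ℝ) = 2 * Real.log ℓ := by
    push_cast; rw [Real.log_pow]; push_cast; rfl
  set L := Real.log ((ℓ ^ 2 : ℕ) : ℝ) with hL
  have hℓR : (0 : ℝ) < ℓ := by exact_mod_cast hℓ
  have hs8 : (s : ℝ) ≤ 8 * ℓ := by
    refine (cell_side_le (x := Real.sqrt κ) (by norm_num) (Real.sqrt_nonneg _)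
      (Real.sq_sqrt (by positivity)) h4').trans ?_
    have : Real.sqrt κ ≤ ℓ := Real.sqrt_le_iff.2 ⟨by positivity, by exact_mod_cast hκn⟩
    linarith
  have hs3 : (s : ℝ) * 3 ^ R ≤ 8 * ℓ := by
    rcases hR' with rfl | h
    · simpa using hs8
    · have : (s : ℝ) * 3 ^ R ≤ 3 * ℓ := by exact_mod_cast h
      linarith
  have hRL : (R : ℝ) + 1 ≤ 4 * L := by
    rcases hR' with rfl | h
    · push_cast; linarith
    · have h1 : 3 ^ R ≤ 3 * ℓ := (Nat.le_mul_of_pos_left _ hs).trans h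
      have h2 : (3 : ℝ) ^ R ≤ 3 * ℓ := by exact_mod_cast h1
      have h3 := Real.log_le_log (by positivity) h2
      rw [Real.log_pow, Real.log_mul (by norm_num) hℓR.ne'] at h3
      have h5 : 1 ≤ Real.log 3 := by
        rw [Real.le_log_iff_exp_le (by norm_num)]
        linarith [Real.exp_one_lt_d9]
      have h6 : (R : ℝ) - 1 ≤ Real.log ℓ := by
        by_contra! h7
        have : 0 < Real.log ℓ := by linarith
        nlinarith
      linarith
  have h := guessProcedure_of_levels (b := 3) (R := R) (B := 30 * (2 * s) * R * 3 ^ R)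
    (α₀ := 1 / Real.sqrt (R + 1)) (by norm_num : 0 < 2) hℓ hs hR h4 h4' (by positivity)
    (fun Ω loc pt act hm hw => by
      obtain ⟨T, α, hT, h1, h2, h3, h5⟩ := HasSearch.levels_of_card_eq_nine (by simp)
        (by omega) hm hw R le_rfl
      refine ⟨T, α, by exact_mod_cast hT, ?_, h2, h5⟩
      rw [div_le_iff₀ (by positivity), ← Real.sqrt_sq h1.le, ← Real.sqrt_mul (by positivity)]
      exact Real.one_le_sqrt.2 h3) v₁
  refine h.mono ?_
  have hL0 : 1 ≤ Real.sqrt L := Real.one_le_sqrt.2 hL1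
  have hLL : 1 ≤ L * Real.sqrt L := one_le_mul_of_one_le_of_one_le hL1 hL0
  have hsq : Real.sqrt (R + 1) ≤ 2 * Real.sqrt L := by
    rw [Real.sqrt_le_left (by positivity), mul_pow, Real.sq_sqrt (by linarith)]
    linarith
  have hmain : (30 * (2 * s) * R * 3 ^ R + 4 * (2 : ℕ) * s) / (1 / Real.sqrt (R + 1)) ≤
      3840 * (ℓ * (L * Real.sqrt L)) := by
    rw [div_div_eq_mul_div, div_one]
    push_cast
    calc (30 * (2 * s) * R * 3 ^ R + 4 * 2 * s) * Real.sqrt (R + 1)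
        = (60 * R * (s * 3 ^ R) + 8 * s) * Real.sqrt (R + 1) := by ring
      _ ≤ (60 * R * (8 * ℓ) + 8 * (8 * ℓ)) * (2 * Real.sqrt L) := by gcongr
      _ ≤ (480 * ℓ * (R + 1)) * (2 * Real.sqrt L) := by gcongr; linarith
      _ ≤ (480 * ℓ * (4 * L)) * (2 * Real.sqrt L) := by gcongr
      _ = _ := by ring
  have h1 : (ℓ : ℝ) ≤ ℓ * (L * Real.sqrt L) := le_mul_of_one_le_right hℓR.le hLL
  have h2 : (1 : ℝ) ≤ ℓ := by exact_mod_cast hℓ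
  push_cast at hmain ⊢
  linarith

/-! ### Combining the guesses. -/

theorem eq_false_of_markedCount_eq_zero {V : Type*} [Fintype V] {X : V → Bool}
    (h : markedCount X = 0) : X = fun _ => false := by
  funext v
  have := Finset.filter_eq_empty_iff.1 (Finset.card_eq_zero.1 h) (Finset.mem_univ v)
  simpa using this

/-- All guesses run in turn, `N` times each, on separate registers, so the probabilities of an unset
flag multiply. Every factor is 1 on the empty input; otherwise one correct guess brings the product
below 1/3, the others being at most 1. -/
theorem exists_robotComplexity_eq_of_guesses {d ℓ : ℕ} {v₁ : Fin d → Fin ℓ} {ι : Type*}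
    {f : ((Fin d → Fin ℓ) → Bool) → Option Bool} (I : Finset ι) (κ : ι → ℕ) (B : ι → ℝ)
    {N : ℕ} (hN : (1 - 1 / (49 * 2 ^ (d + 3)) : ℝ) ^ N ≤ 1 / 3)
    (hfalse : ∀ X, f X = some false → markedCount X = 0)
    (htrue : ∀ X, f X = some true → ∃ i ∈ I, κ i ≤ markedCount X ∧ markedCount X < 2 * κ i)
    (h : ∀ i ∈ I, GuessProcedure d ℓ (κ i) v₁ (B i)) :
    ∃ T : ℕ, robotComplexity (gridGraph d ℓ) v₁ f = T ∧ (T : ℝ) ≤ N * ∑ i ∈ I, B i := by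
  have h' : ∀ i, ∃ T g, i ∈ I → FlagProcedure (gridGraph d ℓ) v₁ T g ∧ g (fun _ => false) = 1 ∧
      (∀ X, κ i ≤ markedCount X → markedCount X < 2 * κ i →
        g X ≤ 1 - 1 / (49 * 2 ^ (d + 3))) ∧ (T : ℝ) ≤ B i := fun i => by
    by_cases hi : i ∈ I
    · obtain ⟨T, g, hg⟩ := h i hi
      exact ⟨T, g, fun _ => hg⟩
    · exact ⟨0, 1, fun hi' => absurd hi' hi⟩
  choose t g hg using h'
  have hpow := FlagProcedure.prod I fun i hi => (hg i hi).1.pow N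
  have hle := hpow.robotComplexity_le (f := f) (fun X hX => ?_) (fun X hX => ?_)
  · obtain ⟨T, hT, hT'⟩ := ENat.le_natCast_iff.1 hle
    refine ⟨T, hT, ?_⟩
    calc (T : ℝ) ≤ ((∑ i ∈ I, N * t i : ℕ) : ℝ) := by exact_mod_cast hT'
      _ = N * ∑ i ∈ I, (t i : ℝ) := by rw [Finset.mul_sum]; push_cast; rfl
      _ ≤ _ := by
          gcongr with i hi
          exact (hg i hi).2.2.2
  · rw [eq_false_of_markedCount_eq_zero (hfalse X hX), Finset.prod_apply,
      Finset.prod_eq_one fun i hi => by rw [Pi.pow_apply, (hg i hi).2.1, one_pow]]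
    norm_num
  · classical
    obtain ⟨i, hi, h1, h2⟩ := htrue X hX
    rw [Finset.prod_apply, ← Finset.mul_prod_erase _ _ hi]
    have h3 : (g i ^ N) X ≤ 1 / 3 :=
      (pow_le_pow_left₀ ((hg i hi).1.nonneg X) ((hg i hi).2.2.1 X h1 h2) N).trans hN
    have h4 : ∏ j ∈ I.erase i, (g j ^ N) X ≤ 1 := Finset.prod_le_one
      (fun j hj => pow_nonneg ((hg j (Finset.mem_of_mem_erase hj)).1.nonneg X) N)
      (fun j hj => pow_le_one₀ ((hg j (Finset.mem_of_mem_erase hj)).1.nonneg X)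
        ((hg j (Finset.mem_of_mem_erase hj)).1.le_one X))
    have h5 : 0 ≤ (g i ^ N) X := pow_nonneg ((hg i hi).1.nonneg X) N
    exact (mul_le_of_le_one_right h5 h4).trans h3

theorem exists_repetitions (d : ℕ) : ∃ N : ℕ, (1 - 1 / (49 * 2 ^ (d + 3)) : ℝ) ^ N ≤ 1 / 3 := by
  obtain ⟨N, hN⟩ := exists_pow_lt_of_lt_one (x := (1 / 3 : ℝ))
    (y := 1 - 1 / (49 * 2 ^ (d + 3))) (by norm_num) (by
      have : (0 : ℝ) < 1 / (49 * 2 ^ (d + 3)) := by positivity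
      linarith)
  exact ⟨N, hN.le⟩

theorem markedCount_eq_zero_of_orExactly {V : Type*} [Fintype V] {k : ℕ} {X : V → Bool}
    (h : orExactly k X = some false) : markedCount X = 0 := by
  by_contra h0
  rw [orExactly, if_neg h0] at h
  split_ifs at h
  simp at h

theorem markedCount_eq_of_orExactly {V : Type*} [Fintype V] {k : ℕ} {X : V → Bool}
    (h : orExactly k X = some true) : markedCount X = k := by
  by_contra hk
  rw [orExactly, if_neg hk] at h
  split_ifs at h
  simp at h

theorem markedCount_eq_zero_of_orAtLeast {V : Type*} [Fintype V] {k : ℕ} {X : V → Bool}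
    (h : orAtLeast k X = some false) : markedCount X = 0 := by
  by_contra h0
  rw [orAtLeast, if_neg h0] at h
  split_ifs at h
  simp at h

theorem le_markedCount_of_orAtLeast {V : Type*} [Fintype V] {k : ℕ} {X : V → Bool}
    (h : orAtLeast k X = some true) : k ≤ markedCount X := by
  by_contra hk
  rw [orAtLeast, if_neg hk] at h
  split_ifs at h
  simp at h

/-- The guesses `2 ^ i * k` cover all possible numbers of marked vertices that are at least `k`. -/
theorem exists_guess {n k K : ℕ} (hk : 1 ≤ k) (hkK : k ≤ K) (hK : K ≤ n) :
    ∃ i ∈ (Finset.range (Nat.log 2 n + 1)).filter (fun i => 2 ^ i * k ≤ n),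
      2 ^ i * k ≤ K ∧ K < 2 * (2 ^ i * k) := by
  have h0 : K / k ≠ 0 := (Nat.div_pos hkK hk).ne'
  have h1 : 2 ^ Nat.log 2 (K / k) * k ≤ K :=
    (Nat.le_div_iff_mul_le hk).1 (Nat.pow_log_le_self 2 h0)
  have h2 : K < 2 ^ (Nat.log 2 (K / k) + 1) * k :=
    (Nat.div_lt_iff_lt_mul hk).1 (Nat.lt_pow_succ_log_self (by norm_num) _)
  have h3 : Nat.log 2 (K / k) ≤ Nat.log 2 n := Nat.log_mono_right ((Nat.div_le_self _ _).trans hK)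
  refine ⟨Nat.log 2 (K / k), ?_, h1, ?_⟩
  · simp only [Finset.mem_filter, Finset.mem_range]
    exact ⟨by omega, h1.trans hK⟩
  · rw [pow_succ'] at h2
    linarith

theorem markedCount_le {d ℓ : ℕ} (X : (Fin d → Fin ℓ) → Bool) : markedCount X ≤ ℓ ^ d := by
  refine (Finset.card_le_univ _).trans (le_of_eq ?_)
  simp

/-- Doubling the guess divides the cost by 2^γ, a geometric series. Positivity of γ = 1/2 - 1/d is
where d ≥ 3 matters. -/
theorem sum_div_rpow_le {A k γ : ℝ} (hA : 0 ≤ A) (hk : 0 < k) (hγ : 0 < γ) (I : Finset ℕ) :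
    ∑ i ∈ I, A / (2 ^ i * k) ^ γ ≤ (1 - (2 : ℝ) ^ (-γ))⁻¹ * (A / k ^ γ) := by
  have hq0 : (0 : ℝ) ≤ 2 ^ (-γ) := by positivity
  have hq1 : (2 : ℝ) ^ (-γ) < 1 := Real.rpow_lt_one_of_one_lt_of_neg (by norm_num) (by linarith)
  have h : ∀ i : ℕ, A / (2 ^ i * k) ^ γ = A / k ^ γ * ((2 : ℝ) ^ (-γ)) ^ i := fun i => by
    rw [Real.mul_rpow (by positivity) hk.le, ← Real.rpow_natCast, ← Real.rpow_mul (by norm_num),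
      ← Real.rpow_natCast, ← Real.rpow_mul (by norm_num), neg_mul, Real.rpow_neg (by norm_num),
      mul_comm γ]
    field_simp
  simp only [h]
  rw [← Finset.mul_sum, mul_comm]
  gcongr
  rw [← tsum_geometric_of_lt_one hq0 hq1]
  exact (summable_geometric_of_lt_one hq0 hq1).sum_le_tsum _ fun i _ => by positivity

theorem natLog_add_one_le {n : ℕ} (hn : 2 ≤ n) : (Nat.log 2 n + 1 : ℝ) ≤ 4 * Real.log n := by
  have h1 : (2 : ℝ) ^ Nat.log 2 n ≤ n := by exact_mod_cast Nat.pow_log_le_self 2 (by omega)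
  have h2 := Real.log_le_log (by positivity) h1
  rw [Real.log_pow] at h2
  have h3 := Real.log_two_gt_d9
  have h4 : Real.log 2 ≤ Real.log n := Real.log_le_log (by norm_num) (by exact_mod_cast hn)
  nlinarith [(Nat.cast_nonneg (Nat.log 2 n) : (0 : ℝ) ≤ (Nat.log 2 n : ℝ))]

theorem two_le_of_two_le_sq {ℓ : ℕ} (h : 2 ≤ ℓ ^ 2) : 2 ≤ ℓ := by
  by_contra! h'
  interval_cases ℓ <;> omega

theorem mainTheorem5 :
    -- known number of marked vertices, dimension at least 3
    (∀ d : ℕ, 3 ≤ d → ∃ C : ℝ, 0 < C ∧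
      ∀ n ℓ k : ℕ, n = ℓ ^ d → 1 ≤ k → k ≤ n → ∀ v₁ : Fin d → Fin ℓ,
        ∃ T : ℕ, robotComplexity (gridGraph d ℓ) v₁ (orExactly k) = T ∧
          (T : ℝ) ≤ C * (Real.sqrt n / (k : ℝ) ^ ((1 / 2 : ℝ) - 1 / (d : ℝ)))) ∧
    -- known number of marked vertices, dimension 2
    (∃ C : ℝ, 0 < C ∧
      ∀ n ℓ k : ℕ, n = ℓ ^ 2 → 2 ≤ n → 1 ≤ k → k ≤ n → ∀ v₁ : Fin 2 → Fin ℓ,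
        ∃ T : ℕ, robotComplexity (gridGraph 2 ℓ) v₁ (orExactly k) = T ∧
          (T : ℝ) ≤ C * (Real.sqrt n * Real.log n ^ (3 / 2 : ℝ))) ∧
    -- at least `k` marked vertices, dimension at least 3
    (∀ d : ℕ, 3 ≤ d → ∃ C : ℝ, 0 < C ∧
      ∀ n ℓ k : ℕ, n = ℓ ^ d → 1 ≤ k → k ≤ n → ∀ v₁ : Fin d → Fin ℓ,
        ∃ T : ℕ, robotComplexity (gridGraph d ℓ) v₁ (orAtLeast k) = T ∧
          (T : ℝ) ≤ C * (Real.sqrt n / (k : ℝ) ^ ((1 / 2 : ℝ) - 1 / (d : ℝ)))) ∧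
    -- at least `k` marked vertices, dimension 2
    (∃ C : ℝ, 0 < C ∧
      ∀ n ℓ k : ℕ, n = ℓ ^ 2 → 2 ≤ n → 1 ≤ k → k ≤ n → ∀ v₁ : Fin 2 → Fin ℓ,
        ∃ T : ℕ, robotComplexity (gridGraph 2 ℓ) v₁ (orAtLeast k) = T ∧
          (T : ℝ) ≤ C * (Real.sqrt n * Real.log n ^ (5 / 2 : ℝ))) := by
  refine ⟨fun d hd => ?_, ?_, fun d hd => ?_, ?_⟩
  · obtain ⟨C, hC, h⟩ := exists_guessProcedure_of_three_le hd
    obtain ⟨N, hN⟩ := exists_repetitions d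
    -- `N + 1` instead of `N` makes the constant evidently positive.
    refine ⟨(N + 1) * C, by positivity, fun n ℓ k hn hk hkn v₁ => ?_⟩
    subst hn
    obtain ⟨T, hT, hT'⟩ := exists_robotComplexity_eq_of_guesses {()} (fun _ => k) _ hN
      (fun X => markedCount_eq_zero_of_orExactly)
      (fun X hX => ⟨(), by simp, (markedCount_eq_of_orExactly hX).ge,
        by rw [markedCount_eq_of_orExactly hX]; omega⟩) (fun _ _ => h ℓ k v₁ hk hkn)
    refine ⟨T, hT, hT'.trans ?_⟩
    rw [Finset.sum_singleton, ← mul_assoc]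
    gcongr
    linarith
  · obtain ⟨C, hC, h⟩ := exists_guessProcedure_two
    obtain ⟨N, hN⟩ := exists_repetitions 2
    refine ⟨(N + 1) * C, by positivity, fun n ℓ k hn hn2 hk hkn v₁ => ?_⟩
    subst hn
    obtain ⟨T, hT, hT'⟩ := exists_robotComplexity_eq_of_guesses {()} (fun _ => k) _ hN
      (fun X => markedCount_eq_zero_of_orExactly)
      (fun X hX => ⟨(), by simp, (markedCount_eq_of_orExactly hX).ge,
        by rw [markedCount_eq_of_orExactly hX]; omega⟩)
      (fun _ _ => h ℓ k v₁ (two_le_of_two_le_sq hn2) hk hkn)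
    refine ⟨T, hT, hT'.trans ?_⟩
    rw [Finset.sum_singleton, ← mul_assoc]
    have := one_le_log_sq (two_le_of_two_le_sq hn2)
    gcongr
    linarith
  · obtain ⟨C, hC, h⟩ := exists_guessProcedure_of_three_le hd
    obtain ⟨N, hN⟩ := exists_repetitions d
    have hγ : 0 < (1 / 2 : ℝ) - 1 / (d : ℝ) := by
      have : (3 : ℝ) ≤ d := by exact_mod_cast hd
      have : 1 / (d : ℝ) ≤ 1 / 3 := one_div_le_one_div_of_le (by norm_num) this
      linarith
    have hq : 0 < (1 - (2 : ℝ) ^ (-((1 / 2 : ℝ) - 1 / (d : ℝ))))⁻¹ :=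
      inv_pos.2 (sub_pos.2 (Real.rpow_lt_one_of_one_lt_of_neg (by norm_num) (by linarith)))
    refine ⟨(N + 1) * C * (1 - (2 : ℝ) ^ (-((1 / 2 : ℝ) - 1 / (d : ℝ))))⁻¹, by positivity,
      fun n ℓ k hn hk hkn v₁ => ?_⟩
    subst hn
    obtain ⟨T, hT, hT'⟩ := exists_robotComplexity_eq_of_guesses _ (fun i => 2 ^ i * k) _ hN
      (fun X => markedCount_eq_zero_of_orAtLeast)
      (fun X hX => exists_guess hk (le_markedCount_of_orAtLeast hX) (markedCount_le X))
      (fun i hi => h ℓ (2 ^ i * k) v₁ (Nat.mul_pos (by positivity) hk) (Finset.mem_filter.1 hi).2)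
    refine ⟨T, hT, hT'.trans ?_⟩
    rw [← Finset.mul_sum]
    push_cast
    calc _ ≤ (N : ℝ) * (C * ((1 - (2 : ℝ) ^ (-((1 / 2 : ℝ) - 1 / (d : ℝ))))⁻¹ *
          (Real.sqrt ((ℓ : ℝ) ^ d) / (k : ℝ) ^ ((1 / 2 : ℝ) - 1 / (d : ℝ))))) := by
          gcongr
          exact sum_div_rpow_le (Real.sqrt_nonneg _) (by exact_mod_cast hk) hγ _
      _ ≤ ((N : ℝ) + 1) * (C * ((1 - (2 : ℝ) ^ (-((1 / 2 : ℝ) - 1 / (d : ℝ))))⁻¹ *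
          (Real.sqrt ((ℓ : ℝ) ^ d) / (k : ℝ) ^ ((1 / 2 : ℝ) - 1 / (d : ℝ))))) := by
          gcongr
          linarith
      _ = _ := by ring
  · obtain ⟨C, hC, h⟩ := exists_guessProcedure_two
    obtain ⟨N, hN⟩ := exists_repetitions 2
    refine ⟨(N + 1) * (4 * C), by positivity, fun n ℓ k hn hn2 hk hkn v₁ => ?_⟩
    subst hn
    have hℓ := two_le_of_two_le_sq hn2
    obtain ⟨T, hT, hT'⟩ := exists_robotComplexity_eq_of_guesses _ (fun i => 2 ^ i * k) _ hN
      (fun X => markedCount_eq_zero_of_orAtLeast)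
      (fun X hX => exists_guess hk (le_markedCount_of_orAtLeast hX) (markedCount_le X))
      (fun i hi => h ℓ (2 ^ i * k) v₁ hℓ (Nat.mul_pos (by positivity) hk)
        (Finset.mem_filter.1 hi).2)
    refine ⟨T, hT, hT'.trans ?_⟩
    have hL := one_le_log_sq hℓ
    set L := Real.log ((ℓ ^ 2 : ℕ) : ℝ) with hLdef
    -- In the plane the cost bound does not improve with the guess, so the O(log n) guesses account
    -- for the additional logarithm.
    have hcard : (((Finset.range (Nat.log 2 (ℓ ^ 2) + 1)).filter
        fun i => 2 ^ i * k ≤ ℓ ^ 2).card : ℝ) ≤ 4 * L := by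
      refine le_trans ?_ (natLog_add_one_le hn2)
      have := (Finset.card_filter_le (Finset.range (Nat.log 2 (ℓ ^ 2) + 1))
        fun i => 2 ^ i * k ≤ ℓ ^ 2)
      rw [Finset.card_range] at this
      exact_mod_cast this
    have hpow : L ^ (5 / 2 : ℝ) = L * L ^ (3 / 2 : ℝ) := by
      rw [show (5 / 2 : ℝ) = 1 + 3 / 2 by norm_num, Real.rpow_add (by linarith), Real.rpow_one]
    rw [Finset.sum_const, nsmul_eq_mul, hpow]
    calc _ ≤ ((N : ℝ) + 1) * (4 * L * (C * (Real.sqrt ((ℓ ^ 2 : ℕ) : ℝ) * L ^ (3 / 2 : ℝ)))) := by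
          gcongr
          linarith
      _ = _ := by ring
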